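/- A metric graph $G$ is given by finitely many points (vertices) and finitely many metric segments (edges) $[0,\ell_e]$, $\ell_e>0$, with each endpoint of each segment glued to a vertex (loops and multiple edges are allowed) so that the result is connected; $d$ is the largest metric on the glued space that is bounded above by the metric of each segment. A theta graph is a metric graph with two vertices and three edges, each of which joins the two vertices. $G$ is theta-containing if some subset of $G$, with its own path metric, is isometric to a theta graph; equivalently, if some theta graph embeds topologically in $G$. (In particular, this holds if there is a distance-preserving map from a theta graph to $G$.) For a metric space $(M,d)$ and a finitely supported $\omega:M\to\mathbb{R}$ put $\gamma_d(\omega)=\sum_{x,y\in M}\omega(x)\omega(y)d(x,y)$, the sum being over ordered pairs, and let the negative type gap be $$\Gamma(M,d)=\sup\Bigl\{\gamma_d(\omega) : \omega \text{ finitely supported},\ \sum_{x}\omega(x)=0,\ \sum_{x}|\omega(x)|=1\Bigr\}.$$ **Corollary.** Let $\mathcal{G}$ be the family of theta-containing metric graphs all of whose edges have length at least $1$. Then $$\inf_{G\in\mathcal{G}}\Gamma(G)\ \ge\ \frac{1}{432}.$$ Moreover, this is witnessed by weights $\pm\frac16$ on six points: every $G\in\mathcal{G}$ has disjoint three-point sets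 $R$ and $B$ with $$\sum_{\{x,y\}\subset R}d(x,y)+\sum_{\{x,y\}\subset B}d(x,y)-\sum_{x\in R,\,y\in B}d(x,y)\ \ge\ \frac1{12}$$ (the first two sums are over unordered pairs), and the function $\omega$ equal to $\frac16$ on $R$, $-\frac16$ on $B$ and $0$ elsewhere satisfies $\sum_x\omega(x)=0$, $\sum_x|\omega(x)|=1$ and $\gamma_d(\omega)\ge\frac1{432}$. -/

import Mathlib

open Set Topology

universe u v

/-- The combinatorial data of a metric graph: finitely many vertices `V`, finitely many edges `E`
(loops and parallel edges are allowed), a positive length for every edge, and the vertices to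
which the two ends of every edge are glued.  Connectedness is what makes the largest metric on the
glued space take finite values. -/
structure MetricGraph where
  V : Type u
  E : Type v
  finV : Finite V
  finE : Finite E
  src : E → V
  tgt : E → V
  len : E → ℝ
  len_pos : ∀ e, 0 < len e
  connected : ∀ a b : V, Relation.EqvGen (fun a b => ∃ e, src e = a ∧ tgt e = b) a b

namespace MetricGraph

/-- The metric segment `[0, len e]`. -/
abbrev Segment (G : MetricGraph.{u, v}) (e : G.E) : Type := Icc (0 : ℝ) (G.len e)

/-- The initial endpoint of a segment. -/
def Segment.first (G : MetricGraph.{u, v}) (e : G.E) : G.Segment e :=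
  ⟨0, left_mem_Icc.2 (G.len_pos e).le⟩

/-- The final endpoint of a segment. -/
def Segment.last (G : MetricGraph.{u, v}) (e : G.E) : G.Segment e :=
  ⟨G.len e, right_mem_Icc.2 (G.len_pos e).le⟩

/-- The gluing: each endpoint of a segment is identified with a vertex. -/
inductive Glue (G : MetricGraph.{u, v}) :
    G.V ⊕ (Σ e : G.E, G.Segment e) → G.V ⊕ (Σ e : G.E, G.Segment e) → Prop
  | first (e : G.E) : Glue G (Sum.inr ⟨e, Segment.first G e⟩) (Sum.inl (G.src e))
  | last (e : G.E) : Glue G (Sum.inr ⟨e, Segment.last G e⟩) (Sum.inl (G.tgt e))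

/-- The points of the metric graph: the disjoint union of the vertices and the segments, modulo
the equivalence relation generated by the gluing. -/
def Point (G : MetricGraph.{u, v}) : Type (max u v) := Quot G.Glue

/-- A vertex as a point of the metric graph. -/
def vertex (G : MetricGraph.{u, v}) (a : G.V) : G.Point := Quot.mk _ (Sum.inl a)

/-- A point of a segment as a point of the metric graph. -/
def onEdge (G : MetricGraph.{u, v}) (e : G.E) (t : G.Segment e) : G.Point :=
  Quot.mk _ (Sum.inr ⟨e, t⟩)

/-- `ρ` is a pseudometric on the glued space that is bounded above by the metric of each segment. -/
structure IsAdmissible (G : MetricGraph.{u, v}) (ρ : G.Point → G.Point → ℝ) : Prop where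
  self : ∀ x, ρ x x = 0
  symm : ∀ x y, ρ x y = ρ y x
  triangle : ∀ x y z, ρ x z ≤ ρ x y + ρ y z
  le_segment : ∀ (e : G.E) (s t : G.Segment e),
    ρ (G.onEdge e s) (G.onEdge e t) ≤ |(s : ℝ) - (t : ℝ)|

/-- The distance: the largest pseudometric on the glued space that is bounded above by the metrics
of the segments.  It is a metric, see the instance below. -/
noncomputable def graphDist (G : MetricGraph.{u, v}) (x y : G.Point) : ℝ :=
  ⨆ ρ : {ρ : G.Point → G.Point → ℝ // G.IsAdmissible ρ}, ρ.1 x y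

section MetricFacts

variable (G : MetricGraph.{u, v})

theorem onEdge_first (e : G.E) : G.onEdge e (Segment.first G e) = G.vertex (G.src e) :=
  Quot.sound (Glue.first e)

theorem onEdge_last (e : G.E) : G.onEdge e (Segment.last G e) = G.vertex (G.tgt e) :=
  Quot.sound (Glue.last e)

theorem point_cases (x : G.Point) : (∃ a, x = G.vertex a) ∨
    ∃ (e : G.E) (t : G.Segment e), 0 < (t : ℝ) ∧ (t : ℝ) < G.len e ∧ x = G.onEdge e t := by
  induction x using Quot.ind with
  | mk p =>
    rcases p with a | ⟨e, t⟩
    · exact Or.inl ⟨a, rfl⟩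
    · rcases t.2.1.eq_or_lt with h | h
      · left
        refine ⟨G.src e, ?_⟩
        rw [← onEdge_first]
        have : t = Segment.first G e := Subtype.ext h.symm
        rw [this]; rfl
      · rcases t.2.2.eq_or_lt with h' | h'
        · left
          refine ⟨G.tgt e, ?_⟩
          rw [← onEdge_last]
          have : t = Segment.last G e := Subtype.ext h'
          rw [this]; rfl
        · exact Or.inr ⟨e, t, h, h', rfl⟩

instance : Nonempty {ρ : G.Point → G.Point → ℝ // G.IsAdmissible ρ} :=
  ⟨⟨fun _ _ => 0, fun _ => rfl, fun _ _ => rfl, fun _ _ _ => by simp, fun _ _ _ => abs_nonneg _⟩⟩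

theorem exists_bound_vertex (a b : G.V) :
    ∃ C, ∀ ρ, G.IsAdmissible ρ → ρ (G.vertex a) (G.vertex b) ≤ C := by
  induction G.connected a b with
  | rel a b h =>
    obtain ⟨e, rfl, rfl⟩ := h
    refine ⟨|((Segment.first G e : G.Segment e) : ℝ) - (Segment.last G e : G.Segment e)|, ?_⟩
    intro ρ hρ
    rw [← onEdge_first, ← onEdge_last]
    exact hρ.le_segment _ _ _
  | refl a => exact ⟨0, fun ρ hρ => (hρ.self _).le⟩
  | symm a b _ ih =>
    obtain ⟨C, hC⟩ := ih
    exact ⟨C, fun ρ hρ => by rw [hρ.symm]; exact hC ρ hρ⟩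
  | trans a b c _ _ ih₁ ih₂ =>
    obtain ⟨C, hC⟩ := ih₁
    obtain ⟨D, hD⟩ := ih₂
    exact ⟨C + D, fun ρ hρ => (hρ.triangle _ (G.vertex b) _).trans
      (add_le_add (hC ρ hρ) (hD ρ hρ))⟩

theorem exists_near_vertex (x : G.Point) :
    ∃ a, ∃ C, ∀ ρ, G.IsAdmissible ρ → ρ x (G.vertex a) ≤ C := by
  rcases G.point_cases x with ⟨a, rfl⟩ | ⟨e, t, -, -, rfl⟩
  · exact ⟨a, 0, fun ρ hρ => (hρ.self _).le⟩
  · refine ⟨G.src e, |(t : ℝ) - (Segment.first G e : G.Segment e)|, fun ρ hρ => ?_⟩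
    rw [← onEdge_first]
    exact hρ.le_segment _ _ _

theorem bddAbove_admissible (x y : G.Point) :
    BddAbove (range fun ρ : {ρ : G.Point → G.Point → ℝ // G.IsAdmissible ρ} => ρ.1 x y) := by
  obtain ⟨a, A, hA⟩ := G.exists_near_vertex x
  obtain ⟨b, B, hB⟩ := G.exists_near_vertex y
  obtain ⟨C, hC⟩ := G.exists_bound_vertex a b
  refine ⟨A + (C + B), ?_⟩
  rintro _ ⟨⟨ρ, hρ⟩, rfl⟩
  have h₁ := hρ.triangle x (G.vertex a) y
  have h₂ := hρ.triangle (G.vertex a) (G.vertex b) y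
  have h₃ := hB ρ hρ
  rw [hρ.symm] at h₃
  have h₄ := hA ρ hρ
  have h₅ := hC ρ hρ
  show ρ x y ≤ _
  linarith

theorem le_graphDist {ρ : G.Point → G.Point → ℝ} (hρ : G.IsAdmissible ρ) (x y : G.Point) :
    ρ x y ≤ G.graphDist x y :=
  le_ciSup (G.bddAbove_admissible x y) ⟨ρ, hρ⟩

theorem isAdmissible_graphDist : G.IsAdmissible G.graphDist where
  self x := by
    have : ∀ ρ : {ρ : G.Point → G.Point → ℝ // G.IsAdmissible ρ}, ρ.1 x x = 0 :=
      fun ρ => ρ.2.self x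
    simp [graphDist, this]
  symm x y := by
    unfold graphDist
    exact iSup_congr fun ρ => ρ.2.symm x y
  triangle x y z := ciSup_le fun ρ => (ρ.2.triangle x y z).trans
    (add_le_add (G.le_graphDist ρ.2 x y) (G.le_graphDist ρ.2 y z))
  le_segment e s t := ciSup_le fun ρ => ρ.2.le_segment e s t

theorem isAdmissible_of_function (g : G.Point → ℝ)
    (hg : ∀ (e : G.E) (s t : G.Segment e),
      |g (G.onEdge e s) - g (G.onEdge e t)| ≤ |(s : ℝ) - (t : ℝ)|) :
    G.IsAdmissible fun x y => |g x - g y| where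
  self x := by simp
  symm x y := abs_sub_comm _ _
  triangle x y z := abs_sub_le _ _ _
  le_segment := hg

theorem graphDist_pos_of_function {x y : G.Point} (g : G.Point → ℝ)
    (hg : ∀ (e : G.E) (s t : G.Segment e),
      |g (G.onEdge e s) - g (G.onEdge e t)| ≤ |(s : ℝ) - (t : ℝ)|)
    (hxy : g x ≠ g y) : 0 < G.graphDist x y :=
  (abs_pos.2 (sub_ne_zero.2 hxy)).trans_le
    (G.le_graphDist (G.isAdmissible_of_function g hg) x y)

open Classical in
theorem graphDist_pos_interior (e : G.E) (t : G.Segment e) (h0 : 0 < (t : ℝ))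
    (h1 : (t : ℝ) < G.len e) (y : G.Point) (hy : G.onEdge e t ≠ y) :
    0 < G.graphDist (G.onEdge e t) y := by
  set ε : ℝ := min (t : ℝ) (G.len e - t) with hε
  have hεpos : 0 < ε := lt_min h0 (by linarith)
  have hε1 : ε ≤ t := min_le_left _ _
  have hε2 : ε ≤ G.len e - t := min_le_right _ _
  let f : G.V ⊕ (Σ e : G.E, G.Segment e) → ℝ := fun p =>
    match p with
    | Sum.inl _ => 0
    | Sum.inr ⟨e', s⟩ => if e' = e then max 0 (ε - |(s : ℝ) - t|) else 0
  have hf : ∀ p q, G.Glue p q → f p = f q := by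
    intro p q h
    cases h with
    | first e' =>
      show (if e' = e then max 0 (ε - |(0 : ℝ) - t|) else 0) = (0 : ℝ)
      split_ifs with h
      · rw [zero_sub, abs_neg, abs_of_pos h0]
        exact max_eq_left (by linarith)
      · rfl
    | last e' =>
      show (if e' = e then max 0 (ε - |G.len e' - t|) else 0) = (0 : ℝ)
      split_ifs with h
      · rw [h, abs_of_pos (by linarith : 0 < G.len e - (t : ℝ))]
        exact max_eq_left (by linarith)
      · rfl
  let g : G.Point → ℝ := Quot.lift f hf
  have hge : ∀ e' (s : G.Segment e'), g (G.onEdge e' s) =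
      if e' = e then max 0 (ε - |(s : ℝ) - t|) else 0 := fun _ _ => rfl
  have hgt : g (G.onEdge e t) = ε := by
    rw [hge]; simp [hεpos.le]
  refine G.graphDist_pos_of_function g ?_ ?_
  · intro e' s s'
    rw [hge, hge]
    split_ifs with h
    · refine (abs_max_sub_max_le_max 0 _ 0 _).trans ?_
      rw [sub_self, abs_zero, sub_sub_sub_cancel_left]
      refine max_le (abs_nonneg _) ?_
      refine (abs_abs_sub_abs_le_abs_sub _ _).trans ?_
      rw [sub_sub_sub_cancel_right, abs_sub_comm]
    · simp
  · rw [hgt]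
    rcases G.point_cases y with ⟨a, rfl⟩ | ⟨e', s, -, -, rfl⟩
    · exact hεpos.ne'
    · rw [hge]
      split_ifs with h
      · subst h
        have hst : (s : ℝ) - t ≠ 0 := fun h => hy (by
          rw [show s = t from Subtype.ext (sub_eq_zero.1 h)])
        have := abs_pos.2 hst
        exact (max_lt hεpos (by linarith)).ne'
      · exact hεpos.ne'

open Classical in
theorem graphDist_pos_vertex (a b : G.V) (hab : G.vertex a ≠ G.vertex b) :
    0 < G.graphDist (G.vertex a) (G.vertex b) := by
  have hne : b ≠ a := fun h => hab (by rw [h])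
  obtain ⟨c, hc, hcl⟩ : ∃ c : ℝ, 0 < c ∧ ∀ e, c ≤ G.len e := by
    have := G.finE
    rcases isEmpty_or_nonempty G.E with h | h
    · exact ⟨1, one_pos, fun e => (h.false e).elim⟩
    · obtain ⟨e₀, he₀⟩ := Finite.exists_min G.len
      exact ⟨G.len e₀, G.len_pos e₀, he₀⟩
  let k : G.V → ℝ := fun w => if w = a then c else 0
  have hk : ∀ w w', |k w - k w'| ≤ c := by
    intro w w'
    simp only [k]
    split_ifs <;> simp [abs_of_pos hc, hc.le]
  let f : G.V ⊕ (Σ e : G.E, G.Segment e) → ℝ := fun p =>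
    match p with
    | Sum.inl w => k w
    | Sum.inr ⟨e, s⟩ => k (G.src e) + (k (G.tgt e) - k (G.src e)) / G.len e * s
  have hf : ∀ p q, G.Glue p q → f p = f q := by
    intro p q h
    cases h with
    | first e =>
      show k (G.src e) + (k (G.tgt e) - k (G.src e)) / G.len e * 0 = k (G.src e)
      ring
    | last e =>
      show k (G.src e) + (k (G.tgt e) - k (G.src e)) / G.len e * G.len e = k (G.tgt e)
      have := (G.len_pos e).ne'
      field_simp
      ring
  refine G.graphDist_pos_of_function (Quot.lift f hf) ?_ ?_
  · intro e s t
    show |(k (G.src e) + (k (G.tgt e) - k (G.src e)) / G.len e * s) -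
      (k (G.src e) + (k (G.tgt e) - k (G.src e)) / G.len e * t)| ≤ _
    rw [add_sub_add_left_eq_sub, ← mul_sub, abs_mul, abs_div, abs_of_pos (G.len_pos e)]
    refine mul_le_of_le_one_left (abs_nonneg _) ?_
    rw [div_le_one (G.len_pos e)]
    exact (hk _ _).trans (hcl e)
  · show k a ≠ k b
    simp [k, hne, hc.ne']

theorem eq_of_graphDist_eq_zero {x y : G.Point} (h : G.graphDist x y = 0) : x = y := by
  by_contra hxy
  rcases G.point_cases x with ⟨a, rfl⟩ | ⟨e, t, h0, h1, rfl⟩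
  · rcases G.point_cases y with ⟨b, rfl⟩ | ⟨e, t, h0, h1, rfl⟩
    · exact (G.graphDist_pos_vertex a b hxy).ne' h
    · rw [G.isAdmissible_graphDist.symm] at h
      exact (G.graphDist_pos_interior e t h0 h1 _ (Ne.symm hxy)).ne' h
  · exact (G.graphDist_pos_interior e t h0 h1 _ hxy).ne' h

end MetricFacts

/-- The metric space underlying a metric graph. -/
noncomputable instance (G : MetricGraph.{u, v}) : MetricSpace G.Point where
  dist := G.graphDist
  dist_self := G.isAdmissible_graphDist.self
  dist_comm := G.isAdmissible_graphDist.symm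
  dist_triangle := G.isAdmissible_graphDist.triangle
  eq_of_dist_eq_zero := G.eq_of_graphDist_eq_zero

/-- The theta graph: two vertices and three segments, of arbitrary positive lengths, each of which
joins the two vertices. -/
def theta (ℓ : Fin 3 → ℝ) (hℓ : ∀ i, 0 < ℓ i) : MetricGraph.{0, 0} where
  V := Bool
  E := Fin 3
  finV := inferInstance
  finE := inferInstance
  src := fun _ => false
  tgt := fun _ => true
  len := ℓ
  len_pos := hℓ
  connected := by
    have h : Relation.EqvGen (fun a b : Bool => ∃ _ : Fin 3, false = a ∧ true = b) false true :=
      Relation.EqvGen.rel _ _ ⟨0, rfl, rfl⟩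
    intro a b
    cases a <;> cases b
    · exact Relation.EqvGen.refl _
    · exact h
    · exact Relation.EqvGen.symm _ _ h
    · exact Relation.EqvGen.refl _

/-- A metric graph is theta-containing if some subset of it is a theta when it is measured with its
own path metric, that is, if there is a topological embedding of a theta graph.  In particular this
holds if there is a distance-preserving map from a theta graph. -/
def IsThetaContaining (G : MetricGraph.{u, v}) : Prop :=
  ∃ (ℓ : Fin 3 → ℝ) (hℓ : ∀ i, 0 < ℓ i) (f : (theta ℓ hℓ).Point → G.Point), IsEmbedding f

end MetricGraph

/-- The theta-containing metric graphs all of whose edges have length at least `1`. -/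
def thetaFamily : Set MetricGraph.{u, v} :=
  {G | G.IsThetaContaining ∧ ∀ e, 1 ≤ G.len e}

section Gap

variable {M : Type*} [MetricSpace M]

/-- `γ_d(ω) = ∑_{x, y} ω(x) ω(y) d(x, y)`, the sum being over all ordered pairs of points of the
support. -/
noncomputable def gammaForm (ω : M →₀ ℝ) : ℝ :=
  ∑ x ∈ ω.support, ∑ y ∈ ω.support, ω x * ω y * dist x y

/-- `ω` has total sum `0` and total absolute sum `1`. -/
def IsGapWeight (ω : M →₀ ℝ) : Prop :=
  ∑ x ∈ ω.support, ω x = 0 ∧ ∑ x ∈ ω.support, |ω x| = 1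

variable (M) in
/-- The negative type gap of a metric space, a supremum in the extended reals. -/
noncomputable def negativeTypeGap : EReal :=
  ⨆ (ω : M →₀ ℝ) (_ : IsGapWeight ω), (gammaForm ω : EReal)

/-- The sum of the distances over the unordered pairs of points of `S`. -/
noncomputable def pairSum (S : Finset M) : ℝ := (∑ x ∈ S, ∑ y ∈ S, dist x y) / 2

/-- The weight `1/6` at each point of `R` and `-1/6` at each point of `B`. -/
noncomputable def redBlueWeight (R B : Finset M) : M →₀ ℝ :=
  ∑ x ∈ R, Finsupp.single x (1 / 6 : ℝ) - ∑ x ∈ B, Finsupp.single x (1 / 6 : ℝ)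

end Gap

/-- The infimum of the negative type gap over a family of metric graphs. -/
noncomputable def negativeTypeGapInf (𝒢 : Set MetricGraph.{u, v}) : EReal :=
  ⨅ G ∈ 𝒢, negativeTypeGap G.Point

/-!
A theta-containing metric graph has an isometric circle `C` and an edge `f` outside it whose ends
see `C` differently, and this forces a violation of the six-point inequality of negative type.

*The circle.* Let `e` be an edge whose ends remain joined after `e` is removed. Any shortest walk
that joins them without using `e`, closed up by `e`, is an isometric circle
(`IsShortestReturn.exists_isometry`): the distance to one end of `e` in the graph without `e`,
truncated at the length of the walk, defines a 1-Lipschitz retraction of the whole graph onto `C`.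

*The ear.* An ear is a walk outside `C` between two different vertices `a`, `b` of `C`. In a
shortest ear, of length `p`, let `f` be an edge at the middle, with ends `z` and `z'`. A walk from
`z` back to `b` first meets `C` at `a`, or else its first part completes an ear, which has length
at least `p` (`IsEar.min_le_dist`). Hence `d(z, ·) - d(z', ·)` changes by at least `1` between `a`
and `b` (`exists_edge_of_isEar`); this is where the bound on the edge lengths enters.

*Six points.* Four points `x, x', y, y'` of `C` that form two antipodal pairs satisfy `d(x, x') +
d(y, y') = d(x, y) + d(x, y') + d(x', y) + d(x', y')`. For points `z` and `w` at positions `s₂`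
and `s₁` on `f`, the six-point expression of `{x, x', z}` and `{y, y', w}` therefore reduces to a
mixed difference of `d(x, z) + d(x', z)`, minus `d(z, w)`. The distance from `x` to the point at
position `s` first grows and then decreases, with the turn at `s = D(x)`, where
`2 D(x) = d(z', x) - d(z, x) + len f`. So the mixed difference is twice the integral over `s` of the difference of
the numbers of turns below `s` for the two pairs. These numbers are integers; if they differ on an
interval of levels, the gain is at least twice the length of the interval, while `d(z, w)` costs
its length only once. Such an interval exists because `D` oscillates by at least `1/2`
(`exists_levelSum_gap`), and `exists_six_points` draws the conclusion.

*Existence of `e` and the ear.* The image of the theta graph contains an interval of some edge `e`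
and, from another of its three arcs, an interval of some edge `g`. A theta graph stays connected
when one point, or interior points of two arcs, are removed. Removing a point of `e` shows that
the ends of `e` are joined by a walk that avoids `e`. If `g` belongs to `C`, removing points of
both `e` and `g` gives a walk that leads from one arc of `C` to the other, and so an ear. If `g`
does not belong to `C` and there were no ear, the part of the graph hanging on `g` would be cut
off by a single vertex. (`IsThetaContaining.exists_isEar`.)
-/

namespace MetricGraph

variable {G : MetricGraph.{u, v}}

/-! ### Functions on a metric graph -/

/-- The function on a metric graph given by its values on vertices and on segments. -/
def glueLift {α : Type*} (k : G.V → α) (g : ∀ e, G.Segment e → α)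
    (h₀ : ∀ e, g e (Segment.first G e) = k (G.src e))
    (h₁ : ∀ e, g e (Segment.last G e) = k (G.tgt e)) : G.Point → α :=
  Quot.lift (fun p => match p with
    | Sum.inl a => k a
    | Sum.inr ⟨e, t⟩ => g e t) (by
      intro p q h
      cases h with
      | first e => exact h₀ e
      | last e => exact h₁ e)

theorem dist_onEdge_le (e : G.E) (s t : G.Segment e) :
    dist (G.onEdge e s) (G.onEdge e t) ≤ |(s : ℝ) - t| :=
  G.isAdmissible_graphDist.le_segment e s t

theorem continuous_onEdge (e : G.E) : Continuous (G.onEdge e) :=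
  (LipschitzWith.of_dist_le_mul (K := 1) fun s t => by
    simpa [Subtype.dist_eq, Real.dist_eq] using dist_onEdge_le e s t).continuous

theorem dist_src_onEdge_le (e : G.E) (s : G.Segment e) :
    dist (G.vertex (G.src e)) (G.onEdge e s) ≤ s := by
  rw [← onEdge_first]
  refine (dist_onEdge_le e _ _).trans ?_
  simp [Segment.first, abs_of_nonneg s.2.1]

theorem dist_tgt_onEdge_le (e : G.E) (s : G.Segment e) :
    dist (G.vertex (G.tgt e)) (G.onEdge e s) ≤ G.len e - s := by
  rw [← onEdge_last]
  refine (dist_onEdge_le e _ _).trans ?_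
  simp [Segment.last, abs_of_nonneg (sub_nonneg.2 s.2.2)]

theorem dist_src_tgt_le (e : G.E) :
    dist (G.vertex (G.src e)) (G.vertex (G.tgt e)) ≤ G.len e := by
  have := dist_src_onEdge_le e (Segment.last G e)
  rwa [onEdge_last] at this

/-- A real function that is 1-Lipschitz on every segment is 1-Lipschitz. -/
theorem abs_sub_le_dist (g : G.Point → ℝ)
    (hg : ∀ (e : G.E) (s t : G.Segment e),
      |g (G.onEdge e s) - g (G.onEdge e t)| ≤ |(s : ℝ) - (t : ℝ)|) (x y : G.Point) :
    |g x - g y| ≤ dist x y :=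
  G.le_graphDist (G.isAdmissible_of_function g hg) x y

theorem abs_min_sub_min_le {a b a' b' c : ℝ} (ha : |a - a'| ≤ c) (hb : |b - b'| ≤ c) :
    |min a b - min a' b'| ≤ c :=
  (abs_min_sub_min_le_max a b a' b').trans (max_le ha hb)

/-- The topology of a metric graph is the quotient topology. -/
theorem continuous_of_continuous_onEdge {Y : Type*} [TopologicalSpace Y] {φ : G.Point → Y}
    (h : ∀ e, Continuous fun s => φ (G.onEdge e s)) : Continuous φ := by
  have := G.finV
  have := G.finE
  let _ : TopologicalSpace G.V := ⊥
  have : DiscreteTopology G.V := ⟨rfl⟩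
  let π : G.V ⊕ (Σ e : G.E, G.Segment e) → G.Point := Quot.mk _
  have hπ : Continuous π :=
    continuous_sum_dom.2 ⟨continuous_of_discreteTopology,
      continuous_sigma fun e => continuous_onEdge e⟩
  have hq : IsQuotientMap π :=
    hπ.isClosedMap.isQuotientMap hπ Quot.mk_surjective
  refine hq.continuous_iff.2 ?_
  exact continuous_sum_dom.2 ⟨continuous_of_discreteTopology, continuous_sigma h⟩

open Classical in
/-- Every path into the interior of a segment enters through one of its two ends. -/
theorem dist_onEdge_eq_min (e : G.E) (s : G.Segment e) (x : G.Point)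
    (hx : ∀ t : G.Segment e, 0 < (t : ℝ) → (t : ℝ) < G.len e → x ≠ G.onEdge e t) :
    dist (G.onEdge e s) x = min (s + dist (G.vertex (G.src e)) x)
      (G.len e - s + dist (G.vertex (G.tgt e)) x) := by
  apply le_antisymm
  · refine le_min ?_ ?_
    · refine (dist_triangle _ (G.vertex (G.src e)) _).trans ?_
      rw [dist_comm (G.onEdge e s)]
      linarith [dist_src_onEdge_le e s]
    · refine (dist_triangle _ (G.vertex (G.tgt e)) _).trans ?_
      rw [dist_comm (G.onEdge e s)]
      linarith [dist_tgt_onEdge_le e s]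
  · have hst := dist_src_tgt_le e
    have h₁ := dist_triangle (G.vertex (G.src e)) (G.vertex (G.tgt e)) x
    have h₂ := dist_triangle (G.vertex (G.tgt e)) (G.vertex (G.src e)) x
    rw [dist_comm (G.vertex (G.tgt e)) (G.vertex (G.src e))] at h₂
    let m : G.Segment e → ℝ := fun s => min (s + dist (G.vertex (G.src e)) x)
      (G.len e - s + dist (G.vertex (G.tgt e)) x)
    let g : G.Point → ℝ := glueLift (fun a => dist (G.vertex a) x)
      (fun f t => if h : f = e then m (h ▸ t) else dist (G.onEdge f t) x)
      (by
        intro f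
        split_ifs with h
        · subst h
          show min (0 + _) (G.len f - 0 + _) = _
          rw [min_eq_left (by linarith), zero_add]
        · rw [onEdge_first])
      (by
        intro f
        split_ifs with h
        · subst h
          show min (G.len f + _) (G.len f - G.len f + _) = _
          rw [min_eq_right (by linarith), sub_self, zero_add]
        · rw [onEdge_last])
    have hge : ∀ t, g (G.onEdge e t) = m t := fun t => by
      show (if h : e = e then m (h ▸ t) else _) = _
      simp
    have hgf : ∀ f, f ≠ e → ∀ t, g (G.onEdge f t) = dist (G.onEdge f t) x := fun f hf t => by
      show (if h : f = e then m (h ▸ t) else _) = _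
      simp [hf]
    have hgx : g x = 0 := by
      rcases G.point_cases x with ⟨a, ha⟩ | ⟨f, t, h0, h1, hf⟩
      · conv_lhs => rw [ha]
        show dist (G.vertex a) x = 0
        rw [ha, dist_self]
      · have hfe : f ≠ e := by
          rintro rfl
          exact hx t h0 h1 hf
        conv_lhs => rw [hf]
        rw [hgf f hfe, hf, dist_self]
    have := abs_sub_le_dist g (fun f s t => by
      by_cases hf : f = e
      · subst hf
        rw [hge, hge]
        refine abs_min_sub_min_le (by rw [add_sub_add_right_eq_sub]) ?_
        rw [add_sub_add_right_eq_sub, sub_sub_sub_cancel_left, abs_sub_comm]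
      · rw [hgf f hf, hgf f hf]
        exact (abs_dist_sub_le _ _ _).trans (dist_onEdge_le f s t)) (G.onEdge e s) x
    rw [hge, hgx, sub_zero] at this
    exact (le_abs_self _).trans this

/-! ### Walks -/

variable (G) in
/-- The edge `e` joins `a` and `b`, in either direction. -/
def Joins (e : G.E) (a b : G.V) : Prop :=
  (G.src e = a ∧ G.tgt e = b) ∨ (G.src e = b ∧ G.tgt e = a)

theorem Joins.symm {e : G.E} {a b : G.V} (h : G.Joins e a b) : G.Joins e b a := Or.symm h

variable (G) in
/-- The list of edges `l`, each passed in either direction, is a walk from one vertex to another. -/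
inductive IsWalk : G.V → List G.E → G.V → Prop
  | nil (a : G.V) : IsWalk a [] a
  | cons {a b c : G.V} {e : G.E} {l : List G.E} :
      G.Joins e a b → IsWalk b l c → IsWalk a (e :: l) c

/-- The length of a list of edges. -/
def walkLength (l : List G.E) : ℝ := (l.map G.len).sum

@[simp] theorem walkLength_nil : walkLength ([] : List G.E) = 0 := rfl

@[simp] theorem walkLength_cons (e : G.E) (l : List G.E) :
    walkLength (e :: l) = G.len e + walkLength l := by simp [walkLength]

@[simp] theorem walkLength_append (l l' : List G.E) :
    walkLength (l ++ l') = walkLength l + walkLength l' := by simp [walkLength]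

@[simp] theorem walkLength_reverse (l : List G.E) :
    walkLength l.reverse = walkLength l := by simp [walkLength, List.sum_reverse]

theorem walkLength_nonneg (l : List G.E) : 0 ≤ walkLength l := by
  induction l with
  | nil => simp
  | cons e l ih => rw [walkLength_cons]; linarith [G.len_pos e]

theorem IsWalk.append {a b c : G.V} {l l' : List G.E} (h : G.IsWalk a l b)
    (h' : G.IsWalk b l' c) : G.IsWalk a (l ++ l') c := by
  induction h with
  | nil => exact h'
  | cons hj _ ih => exact .cons hj (ih h')

theorem Joins.isWalk {e : G.E} {a b : G.V} (h : G.Joins e a b) : G.IsWalk a [e] b :=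
  .cons h (.nil _)

theorem IsWalk.reverse {a b : G.V} {l : List G.E} (h : G.IsWalk a l b) :
    G.IsWalk b l.reverse a := by
  induction h with
  | nil => exact .nil _
  | cons hj _ ih => rw [List.reverse_cons]; exact ih.append hj.symm.isWalk

theorem IsWalk.split {a c : G.V} {l₁ l₂ : List G.E} (h : G.IsWalk a (l₁ ++ l₂) c) :
    ∃ b, G.IsWalk a l₁ b ∧ G.IsWalk b l₂ c := by
  induction l₁ generalizing a with
  | nil => exact ⟨a, .nil _, h⟩
  | cons e l ih =>
    cases h with
    | cons hj h =>
      obtain ⟨b, h₁, h₂⟩ := ih h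
      exact ⟨b, .cons hj h₁, h₂⟩

theorem IsWalk.split_cons {a d : G.V} {l₁ l₂ : List G.E} {e : G.E}
    (h : G.IsWalk a (l₁ ++ e :: l₂) d) :
    ∃ b c, G.IsWalk a l₁ b ∧ G.Joins e b c ∧ G.IsWalk c l₂ d := by
  obtain ⟨b, h₁, h₂⟩ := h.split
  cases h₂ with
  | cons hj h₂ => exact ⟨b, _, h₁, hj, h₂⟩

theorem exists_isWalk (a b : G.V) : ∃ l, G.IsWalk a l b := by
  induction G.connected a b with
  | rel a b h =>
    obtain ⟨e, h₁, h₂⟩ := h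
    exact ⟨[e], Joins.isWalk (Or.inl ⟨h₁, h₂⟩)⟩
  | refl a => exact ⟨[], .nil a⟩
  | symm a b _ ih => exact ⟨_, ih.choose_spec.reverse⟩
  | trans a b c _ _ ih₁ ih₂ => exact ⟨_, ih₁.choose_spec.append ih₂.choose_spec⟩

/-- The lengths of lists of edges are sums of finitely many positive numbers, so they are
well-ordered and minimal lengths are attained. -/
theorem exists_min_walkLength {P : List G.E → Prop} (h : ∃ l, P l) :
    ∃ l, P l ∧ ∀ l', P l' → walkLength l ≤ walkLength l' := by
  have := G.finE
  have hpwo : (AddSubmonoid.closure (range G.len) : Set ℝ).IsPWO := by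
    refine Set.IsPWO.addSubmonoid_closure ?_ (Set.finite_range _).isPWO
    rintro _ ⟨e, rfl⟩
    exact (G.len_pos e).le
  have hmem : ∀ l : List G.E, walkLength l ∈ AddSubmonoid.closure (range G.len) := by
    intro l
    refine AddSubmonoid.list_sum_mem _ ?_
    intro x hx
    obtain ⟨e, -, rfl⟩ := List.mem_map.1 hx
    exact AddSubmonoid.subset_closure ⟨e, rfl⟩
  have hwf : (walkLength '' {l | P l}).IsWF :=
    (hpwo.mono (by rintro _ ⟨l, -, rfl⟩; exact hmem l)).isWF
  have hne : (walkLength '' {l | P l}).Nonempty := by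
    obtain ⟨l, hl⟩ := h
    exact ⟨_, l, hl, rfl⟩
  obtain ⟨l, hl, hl'⟩ := hwf.min_mem hne
  exact ⟨l, hl, fun l' h => hl' ▸ hwf.min_le hne ⟨l', h, rfl⟩⟩

theorem Joins.dist_le {e : G.E} {a b : G.V} (h : G.Joins e a b) :
    dist (G.vertex a) (G.vertex b) ≤ G.len e := by
  have hst := dist_src_tgt_le e
  rcases h with ⟨rfl, rfl⟩ | ⟨rfl, rfl⟩
  · exact hst
  · rwa [dist_comm]

theorem IsWalk.dist_le {a b : G.V} {l : List G.E} (h : G.IsWalk a l b) :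
    dist (G.vertex a) (G.vertex b) ≤ walkLength l := by
  induction h with
  | nil => simp
  | cons hj _ ih =>
    rw [walkLength_cons]
    exact (dist_triangle _ _ _).trans (add_le_add hj.dist_le ih)

/-- Affine interpolation on a segment. -/
noncomputable def interp (k : G.V → ℝ) (e : G.E) (s : G.Segment e) : ℝ :=
  k (G.src e) + (k (G.tgt e) - k (G.src e)) / G.len e * s

@[simp] theorem interp_first (k : G.V → ℝ) (e : G.E) :
    interp k e (Segment.first G e) = k (G.src e) := by
  simp [interp, Segment.first]

@[simp] theorem interp_last (k : G.V → ℝ) (e : G.E) :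
    interp k e (Segment.last G e) = k (G.tgt e) := by
  have := (G.len_pos e).ne'
  simp only [interp, Segment.last]
  field_simp
  ring

theorem abs_interp_sub_le (k : G.V → ℝ) (e : G.E)
    (hk : |k (G.tgt e) - k (G.src e)| ≤ G.len e) (s t : G.Segment e) :
    |interp k e s - interp k e t| ≤ |(s : ℝ) - t| := by
  rw [interp, interp, add_sub_add_left_eq_sub, ← mul_sub, abs_mul, abs_div,
    abs_of_pos (G.len_pos e)]
  refine mul_le_of_le_one_left (abs_nonneg _) ?_
  rwa [div_le_one (G.len_pos e)]

/-- The distance between two vertices is the length of a shortest walk. -/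
theorem exists_isWalk_dist (a b : G.V) :
    ∃ l, G.IsWalk a l b ∧ walkLength l = dist (G.vertex a) (G.vertex b) := by
  choose p hp hmin using fun b => exists_min_walkLength (exists_isWalk a b)
  refine ⟨p b, hp b, le_antisymm ?_ (hp b).dist_le⟩
  let k : G.V → ℝ := fun b => walkLength (p b)
  have hk : ∀ {e : G.E} {b c}, G.Joins e b c → k c ≤ k b + G.len e := fun {e b c} h => by
    simpa using hmin c _ ((hp b).append h.isWalk)
  have hk0 : k a = 0 := le_antisymm (by simpa using hmin a [] (.nil a)) (walkLength_nonneg _)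
  have := abs_sub_le_dist (glueLift k (interp k) (interp_first k) (interp_last k))
    (fun e s t => abs_interp_sub_le k e (by
      have h₁ := hk (e := e) (Or.inl ⟨rfl, rfl⟩)
      have h₂ := hk (e := e) (Or.inr ⟨rfl, rfl⟩)
      rw [abs_le]
      constructor <;> linarith) s t) (G.vertex a) (G.vertex b)
  change |k a - k b| ≤ _ at this
  rw [hk0, zero_sub, abs_neg] at this
  exact (le_abs_self _).trans this

theorem one_le_dist_vertex (hlen : ∀ e, 1 ≤ G.len e) {a b : G.V} (hab : a ≠ b) :
    1 ≤ dist (G.vertex a) (G.vertex b) := by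
  obtain ⟨l, hl, hd⟩ := exists_isWalk_dist a b
  rw [← hd]
  cases hl with
  | nil => exact absurd rfl hab
  | cons _ _ =>
    rename_i e l _ _
    rw [walkLength_cons]
    linarith [hlen e, walkLength_nonneg l]

/-! ### Paths along walks -/

/-- Two 1-Lipschitz paths that fit together form a 1-Lipschitz path. -/
theorem dist_concat_le {M : Type*} [MetricSpace M] {c₁ c₂ : ℝ → M} {A B : ℝ}
    (h₁ : ∀ s ∈ Icc 0 A, ∀ t ∈ Icc 0 A, dist (c₁ s) (c₁ t) ≤ |s - t|)
    (h₂ : ∀ s ∈ Icc 0 B, ∀ t ∈ Icc 0 B, dist (c₂ s) (c₂ t) ≤ |s - t|)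
    (hA : 0 ≤ A) (hB : 0 ≤ B) (h : c₁ A = c₂ 0) :
    ∀ s ∈ Icc 0 (A + B), ∀ t ∈ Icc 0 (A + B),
      dist (if s ≤ A then c₁ s else c₂ (s - A)) (if t ≤ A then c₁ t else c₂ (t - A))
        ≤ |s - t| := by
  have key : ∀ s ∈ Icc 0 (A + B), ∀ t ∈ Icc 0 (A + B), s ≤ t →
      dist (if s ≤ A then c₁ s else c₂ (s - A)) (if t ≤ A then c₁ t else c₂ (t - A))
        ≤ t - s := by
    intro s hs t ht hst
    split_ifs with hsA htA htA
    · simpa [abs_sub_comm s, abs_of_nonneg (sub_nonneg.2 hst)] using h₁ s ⟨hs.1, hsA⟩ t ⟨ht.1, htA⟩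
    · push Not at htA
      have e₁ := h₁ s ⟨hs.1, hsA⟩ A ⟨hA, le_rfl⟩
      have e₂ := h₂ 0 ⟨le_rfl, hB⟩ (t - A) ⟨by linarith, by linarith [ht.2]⟩
      rw [abs_sub_comm, abs_of_nonneg (by linarith)] at e₁ e₂
      rw [h] at e₁
      linarith [dist_triangle (c₁ s) (c₂ 0) (c₂ (t - A))]
    · linarith
    · push Not at hsA htA
      have e₂ := h₂ (s - A) ⟨by linarith, by linarith [hs.2]⟩ (t - A)
        ⟨by linarith, by linarith [ht.2]⟩
      rw [abs_sub_comm, abs_of_nonneg (by linarith)] at e₂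
      linarith
  intro s hs t ht
  rcases le_total s t with hst | hst
  · rw [abs_sub_comm, abs_of_nonneg (sub_nonneg.2 hst)]
    exact key s hs t ht hst
  · rw [abs_of_nonneg (sub_nonneg.2 hst), dist_comm]
    exact key t ht s hs hst

/-- The path `c`, on `[0, walkLength l]`, runs from `a` to `b` along the edges of `l` with unit
speed, and the function `k`, extended affinely to the segments, grows along it with unit speed. -/
structure IsUnitPath (k : G.V → ℝ) (a : G.V) (l : List G.E) (b : G.V) (c : ℝ → G.Point) :
    Prop where
  zero : c 0 = G.vertex a
  last : c (walkLength l) = G.vertex b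
  dist_le : ∀ s ∈ Icc 0 (walkLength l), ∀ t ∈ Icc 0 (walkLength l), dist (c s) (c t) ≤ |s - t|
  cover : l ≠ [] → ∀ t ∈ Icc 0 (walkLength l), ∃ f ∈ l, ∃ s, c t = G.onEdge f s ∧
    interp k f s = k a + t
  surj : ∀ f ∈ l, ∀ s, ∃ t ∈ Icc 0 (walkLength l), c t = G.onEdge f s

theorem Joins.exists_isUnitPath (k : G.V → ℝ) {e : G.E} {a b : G.V} (h : G.Joins e a b)
    (hk : k b = k a + G.len e) : ∃ c, IsUnitPath k a [e] b c := by
  have hpos := G.len_pos e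
  rcases h with ⟨rfl, rfl⟩ | ⟨rfl, rfl⟩
  · have hp : ∀ t ∈ Icc 0 (G.len e), (projIcc 0 (G.len e) hpos.le t : ℝ) = t :=
      fun t ht => by rw [projIcc_of_mem _ ht]
    refine ⟨fun t => G.onEdge e (projIcc 0 (G.len e) hpos.le t), ?_, ?_, ?_, ?_, ?_⟩
    · rw [← onEdge_first]
      exact congrArg _ (Subtype.ext (hp 0 ⟨le_rfl, hpos.le⟩))
    · rw [← onEdge_last]
      exact congrArg _ (Subtype.ext (by simp [Segment.last]))
    · simp only [walkLength_cons, walkLength_nil, add_zero]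
      intro s hs t ht
      refine (dist_onEdge_le _ _ _).trans ?_
      rw [hp s hs, hp t ht]
    · simp only [walkLength_cons, walkLength_nil, add_zero]
      intro _ t ht
      refine ⟨e, by simp, _, rfl, ?_⟩
      rw [interp, hp t ht, hk]
      field_simp
      ring
    · simp only [walkLength_cons, walkLength_nil, add_zero, List.mem_singleton]
      rintro f rfl s
      exact ⟨s, s.2, congrArg _ (Subtype.ext (hp s s.2))⟩
  · have hp : ∀ t ∈ Icc 0 (G.len e),
        (projIcc 0 (G.len e) hpos.le (G.len e - t) : ℝ) = G.len e - t :=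
      fun t ht => by rw [projIcc_of_mem _ ⟨by linarith [ht.2], by linarith [ht.1]⟩]
    refine ⟨fun t => G.onEdge e (projIcc 0 (G.len e) hpos.le (G.len e - t)), ?_, ?_, ?_, ?_, ?_⟩
    · rw [← onEdge_last]
      exact congrArg _ (Subtype.ext (by simp [Segment.last]))
    · rw [← onEdge_first]
      exact congrArg _ (Subtype.ext (by simp [Segment.first]))
    · simp only [walkLength_cons, walkLength_nil, add_zero]
      intro s hs t ht
      refine (dist_onEdge_le _ _ _).trans ?_
      rw [hp s hs, hp t ht, sub_sub_sub_cancel_left, abs_sub_comm]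
    · simp only [walkLength_cons, walkLength_nil, add_zero]
      intro _ t ht
      refine ⟨e, by simp, _, rfl, ?_⟩
      rw [interp, hp t ht, hk]
      field_simp
      ring
    · simp only [walkLength_cons, walkLength_nil, add_zero, List.mem_singleton]
      rintro f rfl s
      have hs : G.len f - s ∈ Icc 0 (G.len f) := ⟨by linarith [s.2.2], by linarith [s.2.1]⟩
      exact ⟨G.len f - s, hs, congrArg _ (Subtype.ext (by simp))⟩

theorem IsUnitPath.concat {k : G.V → ℝ} {a b d : G.V} {l₁ l₂ : List G.E} {c₁ c₂ : ℝ → G.Point}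
    (h₁ : IsUnitPath k a l₁ b c₁) (h₂ : IsUnitPath k b l₂ d c₂) (hl₁ : l₁ ≠ [])
    (hk : k b = k a + walkLength l₁) :
    IsUnitPath k a (l₁ ++ l₂) d
      fun t => if t ≤ walkLength l₁ then c₁ t else c₂ (t - walkLength l₁) := by
  have n₁ := walkLength_nonneg l₁
  have n₂ := walkLength_nonneg l₂
  constructor
  · rw [if_pos n₁, h₁.zero]
  · rw [walkLength_append]
    split_ifs with h
    · have h0 : walkLength l₂ = 0 := by linarith
      rw [h0, add_zero, h₁.last, ← h₂.last, h0, h₂.zero]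
    · rw [add_sub_cancel_left, h₂.last]
  · rw [walkLength_append]
    exact dist_concat_le h₁.dist_le h₂.dist_le n₁ n₂ (h₁.last.trans h₂.zero.symm)
  · rw [walkLength_append]
    intro _ t ht
    split_ifs with h
    · obtain ⟨f, hf, s, hs⟩ := h₁.cover hl₁ t ⟨ht.1, h⟩
      exact ⟨f, List.mem_append_left _ hf, s, hs⟩
    · push Not at h
      have hl₂ : l₂ ≠ [] := by
        rintro rfl
        rw [walkLength_nil] at ht
        linarith [ht.2]
      obtain ⟨f, hf, s, hs, hs'⟩ := h₂.cover hl₂ (t - walkLength l₁)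
        ⟨by linarith, by linarith [ht.2]⟩
      exact ⟨f, List.mem_append_right _ hf, s, hs, by rw [hs', hk]; ring⟩
  · rw [walkLength_append]
    intro f hf s
    rcases List.mem_append.1 hf with hf | hf
    · obtain ⟨t, ht, hts⟩ := h₁.surj f hf s
      exact ⟨t, ⟨ht.1, by linarith [ht.2]⟩, by rw [if_pos ht.2, hts]⟩
    · obtain ⟨t, ht, hts⟩ := h₂.surj f hf s
      refine ⟨walkLength l₁ + t, ⟨by linarith [ht.1], by linarith [ht.2]⟩, ?_⟩
      split_ifs with h
      · have h0 : t = 0 := by linarith [ht.1]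
        rw [h0, add_zero, h₁.last, ← h₂.zero, ← h0, hts]
      · rw [add_sub_cancel_left, hts]

theorem IsWalk.le_add_walkLength {k : G.V → ℝ} {a b : G.V} {l : List G.E} (h : G.IsWalk a l b)
    (hk : ∀ f ∈ l, |k (G.tgt f) - k (G.src f)| ≤ G.len f) : k b ≤ k a + walkLength l := by
  induction h with
  | nil => simp
  | cons hj _ ih =>
    rename_i a b c e l _
    have h₁ := ih fun f hf => hk f (List.mem_cons_of_mem _ hf)
    have h₂ := abs_le.1 (hk e List.mem_cons_self)
    rw [walkLength_cons]
    rcases hj with ⟨rfl, rfl⟩ | ⟨rfl, rfl⟩ <;> linarith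

/-- If a 1-Lipschitz function `k` grows by the full length of a walk, it grows with unit speed
all along it. -/
theorem IsWalk.exists_isUnitPath {k : G.V → ℝ} {a b : G.V} {l : List G.E} (h : G.IsWalk a l b)
    (hk : ∀ f ∈ l, |k (G.tgt f) - k (G.src f)| ≤ G.len f) (hb : k b = k a + walkLength l) :
    ∃ c, IsUnitPath k a l b c := by
  induction h with
  | nil a =>
    refine ⟨fun _ => G.vertex a, rfl, rfl, fun _ _ _ _ => by simp, by simp, by simp⟩
  | cons hj hw ih =>
    rename_i a b d e l
    rw [walkLength_cons] at hb
    have h₁ := hw.le_add_walkLength fun f hf => hk f (List.mem_cons_of_mem _ hf)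
    have h₂ := hj.isWalk.le_add_walkLength (k := k) fun f hf => hk f (by
      rw [List.mem_singleton.1 hf]; exact List.mem_cons_self)
    simp only [walkLength_cons, walkLength_nil, add_zero] at h₂
    obtain ⟨c₂, hc₂⟩ := ih (fun f hf => hk f (List.mem_cons_of_mem _ hf)) (by linarith)
    obtain ⟨c₁, hc₁⟩ := hj.exists_isUnitPath k (by linarith)
    exact ⟨_, hc₁.concat hc₂ (by simp) (by simp; linarith)⟩

/-! ### Isometric circles -/

/-- The walk `l` is a shortest one among the walks with the same ends that avoid the edge `e`,
which joins its ends, so that `l` and `e` form a closed walk. -/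
structure IsShortestReturn (e : G.E) (l : List G.E) : Prop where
  isWalk : G.IsWalk (G.src e) l (G.tgt e)
  notMem : e ∉ l
  le : ∀ l', G.IsWalk (G.src e) l' (G.tgt e) → e ∉ l' → walkLength l ≤ walkLength l'

/-- The distance from `src e` in the graph without the edge `e`, truncated at `D`; the value is also
`D` where that graph has no walk from `src e`. -/
noncomputable def avoidDist (e : G.E) (D : ℝ) (y : G.V) : ℝ :=
  sInf (insert D {d | ∃ l, G.IsWalk (G.src e) l y ∧ e ∉ l ∧ walkLength l = d})

theorem bddBelow_avoidDist (e : G.E) {D : ℝ} (hD : 0 ≤ D) (y : G.V) :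
    BddBelow (insert D {d | ∃ l, G.IsWalk (G.src e) l y ∧ e ∉ l ∧ walkLength l = d}) := by
  refine ⟨0, ?_⟩
  rintro _ (rfl | ⟨l, -, -, rfl⟩)
  · exact hD
  · exact walkLength_nonneg l

theorem avoidDist_le (e : G.E) {D : ℝ} (hD : 0 ≤ D) {y : G.V} {l : List G.E}
    (h : G.IsWalk (G.src e) l y) (he : e ∉ l) : avoidDist e D y ≤ walkLength l :=
  csInf_le (bddBelow_avoidDist e hD y) (Or.inr ⟨l, h, he, rfl⟩)

theorem le_avoidDist (e : G.E) {D x : ℝ} {y : G.V} (h₁ : x ≤ D)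
    (h₂ : ∀ l, G.IsWalk (G.src e) l y → e ∉ l → x ≤ walkLength l) : x ≤ avoidDist e D y := by
  refine le_csInf ⟨D, Or.inl rfl⟩ ?_
  rintro _ (rfl | ⟨l, h, he, rfl⟩)
  · exact h₁
  · exact h₂ l h he

theorem avoidDist_le_add (e : G.E) {D : ℝ} (hD : 0 ≤ D) {f : G.E} (hf : f ≠ e) {x y : G.V}
    (h : G.Joins f x y) : avoidDist e D y ≤ avoidDist e D x + G.len f := by
  rw [← sub_le_iff_le_add]
  refine le_avoidDist e ?_ ?_
  · have : avoidDist e D y ≤ D := csInf_le (bddBelow_avoidDist e hD y) (Or.inl rfl)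
    linarith [G.len_pos f]
  · intro l hl he
    have := avoidDist_le e hD (hl.append h.isWalk) (by simp [he, hf.symm])
    simp only [walkLength_append, walkLength_cons, walkLength_nil, add_zero] at this
    linarith

theorem abs_avoidDist_sub_le (e : G.E) {D : ℝ} (hD : 0 ≤ D) {f : G.E} (hf : f ≠ e) :
    |avoidDist e D (G.tgt f) - avoidDist e D (G.src f)| ≤ G.len f := by
  have h₁ := avoidDist_le_add e hD hf (Or.inl ⟨rfl, rfl⟩)
  have h₂ := avoidDist_le_add e hD hf (Or.inr ⟨rfl, rfl⟩)
  rw [abs_le]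
  constructor <;> linarith

theorem avoidDist_src (e : G.E) {D : ℝ} (hD : 0 ≤ D) : avoidDist e D (G.src e) = 0 :=
  le_antisymm (by simpa using avoidDist_le e hD (.nil _) (by simp))
    (le_avoidDist e hD fun l _ _ => walkLength_nonneg l)

/-- Along a shortest return, `avoidDist` is the distance travelled. -/
theorem IsShortestReturn.avoidDist_eq {e : G.E} {l₁ l₂ : List G.E}
    (h : IsShortestReturn e (l₁ ++ l₂)) {x : G.V} (h₁ : G.IsWalk (G.src e) l₁ x)
    (h₂ : G.IsWalk x l₂ (G.tgt e)) : avoidDist e (walkLength (l₁ ++ l₂)) x = walkLength l₁ := by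
  have hne := h.notMem
  rw [List.mem_append, not_or] at hne
  refine le_antisymm (avoidDist_le e (walkLength_nonneg _) h₁ hne.1) (le_avoidDist e ?_ ?_)
  · rw [walkLength_append]
    linarith [walkLength_nonneg l₂]
  · intro l' hl' he
    have := h.le _ (hl'.append h₂) (by simp [he, hne.2])
    simpa using this

theorem norm_coe_addCircle_le (p x : ℝ) : ‖(x : AddCircle p)‖ ≤ |x| := by
  exact QuotientAddGroup.norm_mk_le_norm

/-- A point of a circle lies on an arc of half the length between any two antipodal points. -/
theorem norm_add_norm_add_half_le {p : ℝ} (hp : 0 < p) (θ : AddCircle p) :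
    ‖θ‖ + ‖θ + (p / 2 : ℝ)‖ ≤ p / 2 := by
  obtain ⟨x, rfl⟩ := QuotientAddGroup.mk_surjective θ
  change ‖(x : AddCircle p)‖ + ‖(x : AddCircle p) + (p / 2 : ℝ)‖ ≤ p / 2
  obtain ⟨t, hxt, ht⟩ : ∃ t : ℝ, (x : AddCircle p) = t ∧ ‖(x : AddCircle p)‖ = |t| := by
    refine ⟨x - round (p⁻¹ * x) * p, ?_, AddCircle.norm_eq p⟩
    rw [AddCircle.coe_sub, ← zsmul_eq_mul, AddCircle.coe_zsmul, AddCircle.coe_period, smul_zero,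
      sub_zero]
  have hle := AddCircle.norm_le_half_period p (x := (x : AddCircle p)) hp.ne'
  rw [ht, abs_of_pos hp] at hle
  rw [ht, hxt]
  rcases le_total t 0 with h | h
  · rw [abs_of_nonpos h] at hle ⊢
    have := norm_coe_addCircle_le p (t + p / 2)
    rw [abs_of_nonneg (by linarith), AddCircle.coe_add] at this
    linarith
  · rw [abs_of_nonneg h] at hle ⊢
    have := norm_coe_addCircle_le p (t - p / 2)
    rw [abs_of_nonpos (by linarith)] at this
    have e : ((t - p / 2 : ℝ) : AddCircle p) = (t : AddCircle p) + (p / 2 : ℝ) := by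
      rw [← AddCircle.coe_add, ← sub_eq_zero, ← AddCircle.coe_sub,
        show t - p / 2 - (t + p / 2) = -p by ring, AddCircle.coe_neg, AddCircle.coe_period,
        neg_zero]
    rw [e] at this
    linarith

open Classical in
/-- The retraction of a metric graph onto the closed walk formed by an edge `e` and a shortest
return. -/
noncomputable def retract (e : G.E) (l : List G.E) (h : IsShortestReturn e l) :
    G.Point → AddCircle (walkLength l + G.len e) :=
  glueLift (fun y => (avoidDist e (walkLength l) y : ℝ))
    (fun f s => if f = e then ((walkLength l + G.len e - s : ℝ) : AddCircle _)
      else (interp (avoidDist e (walkLength l)) f s : ℝ))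
    (by
      intro f
      split_ifs with hf
      · subst hf
        rw [avoidDist_src _ (walkLength_nonneg _)]
        simp only [Segment.first, sub_zero, AddCircle.coe_zero, AddCircle.coe_period]
      · rw [interp_first])
    (by
      intro f
      split_ifs with hf
      · subst hf
        have h' := h
        rw [← List.append_nil l] at h'
        have := h'.avoidDist_eq h.isWalk (.nil _)
        rw [List.append_nil] at this
        rw [this]
        simp [Segment.last]
      · rw [interp_last])

theorem norm_retract_sub_le {e : G.E} {l : List G.E} (h : IsShortestReturn e l) (x y : G.Point) :
    ‖retract e l h x - retract e l h y‖ ≤ dist x y := by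
  refine G.le_graphDist (ρ := fun x y => ‖retract e l h x - retract e l h y‖) ?_ x y
  refine ⟨fun x => by simp, fun x y => norm_sub_rev _ _,
    fun x y z => norm_sub_le_norm_sub_add_norm_sub _ _ _, ?_⟩
  intro f s t
  by_cases hf : f = e
  · have hr : ∀ s, retract e l h (G.onEdge f s) =
        ((walkLength l + G.len e - s : ℝ) : AddCircle _) := fun s => if_pos hf
    rw [hr, hr, ← AddCircle.coe_sub]
    refine (norm_coe_addCircle_le _ _).trans ?_
    rw [sub_sub_sub_cancel_left, abs_sub_comm]
  · have hr : ∀ s, retract e l h (G.onEdge f s) =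
        (interp (avoidDist e (walkLength l)) f s : ℝ) := fun s => if_neg hf
    rw [hr, hr, ← AddCircle.coe_sub]
    exact (norm_coe_addCircle_le _ _).trans
      (abs_interp_sub_le _ f (abs_avoidDist_sub_le e (walkLength_nonneg l) hf) s t)

/-- An edge and a shortest return form an isometrically embedded circle. -/
theorem IsShortestReturn.exists_isometry {e : G.E} {l : List G.E} (h : IsShortestReturn e l) :
    ∃ c : AddCircle (walkLength l + G.len e) → G.Point, Isometry c ∧
      (∀ θ, ∃ f ∈ e :: l, ∃ s, c θ = G.onEdge f s) ∧
      ∀ f ∈ e :: l, ∀ s, ∃ θ, c θ = G.onEdge f s := by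
  have hD := walkLength_nonneg l
  have hpos := G.len_pos e
  set D := walkLength l with hDdef
  have hL : 0 < D + G.len e := by linarith
  have hsrc : avoidDist e D (G.src e) = 0 := avoidDist_src _ hD
  have htgt : avoidDist e D (G.tgt e) = D := by
    have h' := h
    rw [← List.append_nil l] at h'
    have := h'.avoidDist_eq h.isWalk (.nil _)
    rwa [List.append_nil] at this
  obtain ⟨c₁, hc₁⟩ := h.isWalk.exists_isUnitPath (k := avoidDist e D)
    (fun f hf => abs_avoidDist_sub_le e hD (by rintro rfl; exact h.notMem hf))
    (by rw [hsrc, htgt, zero_add])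
  let c₂ : ℝ → G.Point := fun t => G.onEdge e (projIcc 0 (G.len e) hpos.le (G.len e - t))
  have hp : ∀ t ∈ Icc 0 (G.len e),
      (projIcc 0 (G.len e) hpos.le (G.len e - t) : ℝ) = G.len e - t :=
    fun t ht => by rw [projIcc_of_mem _ ⟨by linarith [ht.2], by linarith [ht.1]⟩]
  have h₂0 : c₂ 0 = G.vertex (G.tgt e) := by
    rw [← onEdge_last]
    exact congrArg (G.onEdge e) (Subtype.ext (by simp [Segment.last]))
  have h₂1 : c₂ (G.len e) = G.vertex (G.src e) := by
    rw [← onEdge_first]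
    exact congrArg (G.onEdge e) (Subtype.ext (by simp [Segment.first]))
  -- `P` runs around the circle once: along the walk, and back along `e`.
  let P : ℝ → G.Point := fun t => if t ≤ D then c₁ t else c₂ (t - D)
  have hPlip : ∀ s ∈ Icc 0 (D + G.len e), ∀ t ∈ Icc 0 (D + G.len e),
      dist (P s) (P t) ≤ |s - t| := by
    refine dist_concat_le hc₁.dist_le ?_ hD hpos.le (hc₁.last.trans h₂0.symm)
    intro s hs t ht
    refine (dist_onEdge_le _ _ _).trans ?_
    rw [hp s hs, hp t ht, sub_sub_sub_cancel_left, abs_sub_comm]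
  have hP0 : P 0 = G.vertex (G.src e) := by
    simp only [P]
    rw [if_pos hD, hc₁.zero]
  have hPL : P (D + G.len e) = G.vertex (G.src e) := by
    simp only [P]
    rw [if_neg (by linarith), add_sub_cancel_left, h₂1]
  have hPcover : ∀ t ∈ Icc 0 (D + G.len e), (∃ f ∈ e :: l, ∃ s, P t = G.onEdge f s) ∧
      retract e l h (P t) = (t : ℝ) := by
    intro t ht
    simp only [P]
    split_ifs with htD
    · by_cases hl : l = []
      · have h0 : t = 0 := le_antisymm (by simpa [hDdef, hl] using htD) ht.1
        rw [h0, hc₁.zero]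
        refine ⟨⟨e, by simp, Segment.first G e, (onEdge_first G e).symm⟩, ?_⟩
        show ((avoidDist e D (G.src e) : ℝ) : AddCircle (D + G.len e)) = _
        rw [hsrc]
      · obtain ⟨f, hf, s, hs, hs'⟩ := hc₁.cover hl t ⟨ht.1, htD⟩
        refine ⟨⟨f, List.mem_cons_of_mem _ hf, s, hs⟩, ?_⟩
        rw [hs]
        have hfe : f ≠ e := by rintro rfl; exact h.notMem hf
        refine (if_neg hfe).trans ?_
        rw [hs', hsrc, zero_add]
    · refine ⟨⟨e, by simp, _, rfl⟩, (if_pos rfl).trans ?_⟩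
      push Not at htD
      rw [hp _ ⟨by linarith, by linarith [ht.2]⟩]
      congr 1
      ring
  have hPsurj : ∀ f ∈ e :: l, ∀ s, ∃ t ∈ Icc 0 (D + G.len e), P t = G.onEdge f s := by
    intro f hf s
    rcases List.mem_cons.1 hf with rfl | hf
    · have hs : G.len f - s ∈ Icc 0 (G.len f) := ⟨by linarith [s.2.2], by linarith [s.2.1]⟩
      refine ⟨D + (G.len f - s), ⟨by linarith [hs.1], by linarith [hs.2]⟩, ?_⟩
      have hc : c₂ (G.len f - s) = G.onEdge f s :=
        congrArg (G.onEdge f) (Subtype.ext (by rw [hp _ hs]; ring))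
      simp only [P]
      split_ifs with hD'
      · have h0 : G.len f - s = 0 := by linarith [hs.1]
        rw [h0, add_zero, hc₁.last, ← h₂0, ← hc, h0]
      · rw [add_sub_cancel_left, hc]
    · obtain ⟨t, ht, hts⟩ := hc₁.surj f hf s
      exact ⟨t, ⟨ht.1, by linarith [ht.2]⟩, by simp only [P]; rw [if_pos ht.2, hts]⟩
  -- The shorter arc between two points may run through the base point `src e`.
  have hupper : ∀ s ∈ Icc 0 (D + G.len e), ∀ t ∈ Icc 0 (D + G.len e), s ≤ t →
      dist (P s) (P t) ≤ ‖((t - s : ℝ) : AddCircle (D + G.len e))‖ := by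
    intro s hs t ht hst
    rcases le_total (t - s) ((D + G.len e) / 2) with hle | hle
    · rw [(AddCircle.norm_coe_eq_abs_iff _ hL.ne').2
        (by rwa [abs_of_pos hL, abs_of_nonneg (by linarith)]), abs_sub_comm]
      exact hPlip s hs t ht
    · have e₁ : ((t - s : ℝ) : AddCircle (D + G.len e)) = ((t - s - (D + G.len e) : ℝ) :) := by
        rw [AddCircle.coe_sub (x := t - s) (y := D + G.len e), AddCircle.coe_period, sub_zero]
      rw [e₁, (AddCircle.norm_coe_eq_abs_iff _ hL.ne').2
        (by
          rw [abs_of_pos hL, abs_of_nonpos (by linarith [ht.2, hs.1])]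
          linarith), abs_of_nonpos (by linarith [ht.2, hs.1])]
      have d₁ := hPlip s hs 0 ⟨le_rfl, hL.le⟩
      have d₂ := hPlip (D + G.len e) ⟨hL.le, le_rfl⟩ t ht
      rw [sub_zero, abs_of_nonneg hs.1] at d₁
      rw [abs_of_nonneg (by linarith [ht.2]), hPL, ← hP0] at d₂
      linarith [dist_triangle (P s) (P 0) (P t)]
  have hrep : ∀ θ : AddCircle (D + G.len e), ∃ t : ℝ,
      t ∈ Icc 0 (D + G.len e) ∧ (t : AddCircle _) = θ := by
    intro θ
    have : Fact (0 < D + G.len e) := ⟨hL⟩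
    obtain ⟨t, ht, rfl⟩ := AddCircle.eq_coe_Ico θ
    exact ⟨t, Ico_subset_Icc_self ht, rfl⟩
  choose τ hτ hτθ using hrep
  have hr : ∀ θ, retract e l h (P (τ θ)) = θ := fun θ => by
    rw [(hPcover _ (hτ θ)).2, hτθ]
  refine ⟨fun θ => P (τ θ), Isometry.of_dist_eq fun θ η => le_antisymm ?_ ?_, ?_, ?_⟩
  · rcases le_total (τ θ) (τ η) with hle | hle
    · have := hupper _ (hτ θ) _ (hτ η) hle
      rwa [AddCircle.coe_sub, hτθ, hτθ, ← dist_eq_norm, dist_comm η] at this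
    · have := hupper _ (hτ η) _ (hτ θ) hle
      rwa [AddCircle.coe_sub, hτθ, hτθ, ← dist_eq_norm, dist_comm (P _)] at this
  · have := norm_retract_sub_le h (P (τ θ)) (P (τ η))
    rwa [hr, hr, ← dist_eq_norm] at this
  · exact fun θ => (hPcover _ (hτ θ)).1
  · intro f hf s
    obtain ⟨t, ht, hts⟩ := hPsurj f hf s
    refine ⟨(t : ℝ), ?_⟩
    rw [← hts, ← dist_eq_zero]
    refine le_antisymm ?_ dist_nonneg
    rcases le_total (τ (t : ℝ)) t with hle | hle
    · have := hupper _ (hτ _) _ ht hle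
      rwa [AddCircle.coe_sub, hτθ, sub_self, norm_zero] at this
    · have := hupper _ ht _ (hτ _) hle
      rwa [AddCircle.coe_sub, hτθ, sub_self, norm_zero, dist_comm] at this

/-! ### Ears -/

/-- The vertex `y` is an end of an edge in `C`. -/
def IsEndOf (C : Set G.E) (y : G.V) : Prop := ∃ f ∈ C, G.src f = y ∨ G.tgt f = y

/-- The walk `l` avoids the edges in `C` and links two different vertices `a` and `b` of `C`.  It
may have further vertices in common with `C`. -/
structure IsEar (C : Set G.E) (a : G.V) (l : List G.E) (b : G.V) : Prop where
  isWalk : G.IsWalk a l b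
  notMem : ∀ f ∈ l, f ∉ C
  left : IsEndOf C a
  right : IsEndOf C b
  ne : a ≠ b

theorem Joins.isEndOf_left {C : Set G.E} {e : G.E} {a b : G.V} (h : G.Joins e a b) (he : e ∈ C) :
    IsEndOf C a := by
  rcases h with ⟨h, -⟩ | ⟨-, h⟩
  · exact ⟨e, he, Or.inl h⟩
  · exact ⟨e, he, Or.inr h⟩

theorem IsWalk.exists_first_isEndOf {C : Set G.E} {a b : G.V} {l : List G.E}
    (h : G.IsWalk a l b) (hb : IsEndOf C b) :
    ∃ w l₁ l₂, G.IsWalk a l₁ w ∧ (∀ f ∈ l₁, f ∉ C) ∧ IsEndOf C w ∧ G.IsWalk w l₂ b ∧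
      walkLength l = walkLength l₁ + walkLength l₂ := by
  induction h with
  | nil a => exact ⟨a, [], [], .nil a, by simp, hb, .nil a, by simp⟩
  | cons hj hw ih =>
    rename_i a x b e l
    by_cases ha : IsEndOf C a
    · exact ⟨a, [], e :: l, .nil a, by simp, ha, .cons hj hw, by simp⟩
    · obtain ⟨w, l₁, l₂, h₁, h₂, h₃, h₄, h₅⟩ := ih hb
      refine ⟨w, e :: l₁, l₂, .cons hj h₁, ?_, h₃, h₄, by simp [h₅, add_assoc]⟩
      intro f hf
      rcases List.mem_cons.1 hf with rfl | hf
      · exact fun hC => ha (hj.isEndOf_left hC)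
      · exact h₂ f hf

theorem exists_middle_edge {l : List G.E} {x : ℝ} (h₀ : 0 ≤ x) (h₁ : x < walkLength l) :
    ∃ l₁ f l₂, l = l₁ ++ f :: l₂ ∧ walkLength l₁ ≤ x ∧ x ≤ walkLength l₁ + G.len f := by
  induction l generalizing x with
  | nil => exact absurd h₁ (by simpa using h₀)
  | cons e l ih =>
    rcases le_total x (G.len e) with h | h
    · exact ⟨[], e, l, rfl, by simpa using h₀, by simpa using h⟩
    · rw [walkLength_cons] at h₁
      obtain ⟨l₁, f, l₂, rfl, h₂, h₃⟩ := ih (x := x - G.len e) (by linarith) (by linarith)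
      refine ⟨e :: l₁, f, l₂, rfl, ?_, ?_⟩ <;> rw [walkLength_cons] <;> linarith

/-- If a shortest ear starts at `a` with a piece `l₁` that ends at `z`, then a walk from `z` back
to `b` passes through `a` or has the length of the rest of the ear. -/
theorem IsEar.min_le_dist {C : Set G.E} {a b z : G.V} {l₁ l₂ : List G.E}
    (h : IsEar C a (l₁ ++ l₂) b)
    (hmin : ∀ a' l' b', IsEar C a' l' b' → walkLength (l₁ ++ l₂) ≤ walkLength l')
    (h₁ : G.IsWalk a l₁ z) (h₂ : G.IsWalk z l₂ b) :
    min (walkLength l₁ + dist (G.vertex a) (G.vertex b)) (walkLength l₂) ≤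
      dist (G.vertex z) (G.vertex b) := by
  obtain ⟨l, hl, hd⟩ := exists_isWalk_dist z b
  obtain ⟨w, m₁, m₂, hm₁, hmC, hw, hm₂, hm⟩ := hl.exists_first_isEndOf h.right
  rw [← hd, hm]
  have hn := h.notMem
  simp only [List.mem_append, or_imp, forall_and] at hn
  by_cases hwa : w = a
  · subst hwa
    refine (min_le_left _ _).trans (add_le_add ?_ hm₂.dist_le)
    have := hmin _ _ _ ⟨hm₁.reverse.append h₂, by
      simp only [List.mem_append, List.mem_reverse, or_imp, forall_and]
      exact ⟨hmC, hn.2⟩, h.left, h.right, h.ne⟩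
    simpa using this
  · refine (min_le_right _ _).trans ?_
    have := hmin _ _ _ ⟨h₁.append hm₁, by
      simp only [List.mem_append, or_imp, forall_and]
      exact ⟨hn.1, hmC⟩, h.left, hw, Ne.symm hwa⟩
    simp only [walkLength_append] at this
    linarith [walkLength_nonneg m₂]

/-- The distances to the two ends of an edge in the middle of a shortest ear compare differently at
the two ends of the ear. -/
theorem exists_edge_of_isEar (hlen : ∀ e, 1 ≤ G.len e) {C : Set G.E}
    (h : ∃ a l b, IsEar C a l b) :
    ∃ f ∉ C, ∃ a b, IsEndOf C a ∧ IsEndOf C b ∧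
      1 ≤ (dist (G.vertex (G.src f)) (G.vertex b) - dist (G.vertex (G.tgt f)) (G.vertex b)) -
        (dist (G.vertex (G.src f)) (G.vertex a) - dist (G.vertex (G.tgt f)) (G.vertex a)) := by
  obtain ⟨l, ⟨a, b, hl⟩, hmin⟩ := exists_min_walkLength
    (P := fun l => ∃ a b, IsEar C a l b) (by obtain ⟨a, l, b, h⟩ := h; exact ⟨l, a, b, h⟩)
  replace hmin : ∀ a' l' b', IsEar C a' l' b' → walkLength l ≤ walkLength l' :=
    fun a' l' b' h => hmin l' ⟨a', b', h⟩
  have hd := one_le_dist_vertex hlen hl.ne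
  have hpos : 0 < walkLength l := by linarith [hl.isWalk.dist_le]
  obtain ⟨l₁, f, l₂, rfl, hx₁, hx₂⟩ := exists_middle_edge (l := l) (x := walkLength l / 2)
    (by linarith) (by linarith)
  obtain ⟨z, z', h₁, hj, h₂⟩ := hl.isWalk.split_cons
  have key : 1 ≤ (dist (G.vertex z) (G.vertex b) - dist (G.vertex z') (G.vertex b)) -
      (dist (G.vertex z) (G.vertex a) - dist (G.vertex z') (G.vertex a)) := by
    have b₁ := hl.min_le_dist hmin h₁ (.cons hj h₂)
    have b₂ : min (walkLength l₂ + dist (G.vertex a) (G.vertex b)) (G.len f + walkLength l₁) ≤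
        dist (G.vertex z') (G.vertex a) := by
      have hl' : IsEar C b (l₂.reverse ++ f :: l₁.reverse) a :=
        ⟨h₂.reverse.append (.cons hj.symm h₁.reverse), fun g hg => hl.notMem g (by
          simp only [List.mem_append, List.mem_reverse, List.mem_cons] at hg ⊢
          tauto), hl.right, hl.left, hl.ne.symm⟩
      have := hl'.min_le_dist (fun a' l' b' h => by
        have := hmin a' l' b' h
        simp only [walkLength_append, walkLength_cons, walkLength_reverse] at this ⊢
        linarith) h₂.reverse (.cons hj.symm h₁.reverse)
      simpa [dist_comm (G.vertex b)] using this
    have b₃ := h₁.dist_le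
    have b₄ := h₂.dist_le
    rw [dist_comm] at b₃
    simp only [walkLength_append, walkLength_cons] at hx₁ hx₂ b₁
    have hf := hlen f
    rcases min_le_iff.1 b₁ with b₁ | b₁ <;> rcases min_le_iff.1 b₂ with b₂ | b₂ <;> linarith
  have hfC : f ∉ C := hl.notMem f (by simp)
  rcases hj with ⟨rfl, rfl⟩ | ⟨rfl, rfl⟩
  · exact ⟨f, hfC, a, b, hl.left, hl.right, key⟩
  · exact ⟨f, hfC, b, a, hl.right, hl.left, by linarith⟩

/-! ### Six points -/

/-- The number of the points `x` and `σ x` at which `D` lies below a level, integrated over all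
levels up to `s`. -/
noncomputable def levelSum {X : Type*} (σ : X → X) (D : X → ℝ) (s : ℝ) (x : X) : ℝ :=
  max 0 (s - D x) + max 0 (s - D (σ x))

/-- If a function on a circle oscillates, then the number of points of an antipodal pair below a
level depends on the pair, for a whole interval of levels. -/
theorem exists_levelSum_gap {X : Type*} [TopologicalSpace X] [CompactSpace X] [ConnectedSpace X]
    {σ : X → X} (hσ : Continuous σ) (hσσ : ∀ x, σ (σ x) = x) {D : X → ℝ} (hD : Continuous D)
    {ℓ : ℝ} (h₀ : ∀ x, 0 ≤ D x) (h₁ : ∀ x, D x ≤ ℓ) {p q : X} (hpq : D p + 1 / 2 ≤ D q) :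
    ∃ x y s₁ s₂, 0 < s₁ ∧ s₁ < s₂ ∧ s₂ < ℓ ∧
      1 / 12 + (s₂ - s₁) ≤ 2 * ((levelSum σ D s₂ y - levelSum σ D s₁ y) -
        (levelSum σ D s₂ x - levelSum σ D s₁ x)) := by
  obtain ⟨a, -, ha⟩ := isCompact_univ.exists_isMinOn ⟨p, mem_univ p⟩ hD.continuousOn
  obtain ⟨b, -, hb⟩ := isCompact_univ.exists_isMaxOn ⟨p, mem_univ p⟩ hD.continuousOn
  replace ha : ∀ x, D a ≤ D x := fun x => ha (mem_univ x)
  replace hb : ∀ x, D x ≤ D b := fun x => hb (mem_univ x)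
  obtain ⟨k, hk⟩ : ∃ k, D k = D (σ k) := by
    obtain ⟨k, hk⟩ := mem_range_of_exists_le_of_exists_ge (c := (0 : ℝ))
      (f := fun x => D x - D (σ x)) (by fun_prop)
      ⟨a, by linarith [ha (σ a)]⟩ ⟨σ a, by simp only [hσσ]; linarith [ha (σ a)]⟩
    exact ⟨k, by linarith⟩
  have hab : D a + 1 / 2 ≤ D b := by linarith [ha p, hb q]
  have := h₀ a
  have := h₁ b
  have := ha (σ a)
  have := hb (σ b)
  simp only [levelSum]
  -- The minimum of `D` is attained at `a`, the maximum at `b`, and `k` is balanced.  The balanced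
  -- orbit jumps from no point below the level to two points at `D k`.  If `D k` is far from the
  -- minimum it is compared with the orbit of `a`, which has one or two points below a level between
  -- `D a` and `D k`; otherwise it is compared with the orbit of `b`.
  rcases le_total (D a + 1 / 4) (D k) with h | h
  · rcases le_total (D a + 1 / 8) (D (σ a)) with h' | h'
    · refine ⟨k, a, D a + 1 / 24, D a + 1 / 8, by linarith, by linarith, by linarith, ?_⟩
      rw [← hk, max_eq_right (a := 0) (b := D a + 1 / 8 - D a) (by linarith),
        max_eq_right (a := 0) (b := D a + 1 / 24 - D a) (by linarith),
        max_eq_left (a := 0) (b := D a + 1 / 8 - D (σ a)) (by linarith),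
        max_eq_left (a := 0) (b := D a + 1 / 24 - D (σ a)) (by linarith),
        max_eq_left (a := 0) (b := D a + 1 / 8 - D k) (by linarith),
        max_eq_left (a := 0) (b := D a + 1 / 24 - D k) (by linarith)]
      linarith
    · refine ⟨k, a, D a + 1 / 8, D a + 1 / 4, by linarith, by linarith, by linarith, ?_⟩
      rw [← hk, max_eq_right (a := 0) (b := D a + 1 / 4 - D a) (by linarith),
        max_eq_right (a := 0) (b := D a + 1 / 8 - D a) (by linarith),
        max_eq_right (a := 0) (b := D a + 1 / 4 - D (σ a)) (by linarith),
        max_eq_right (a := 0) (b := D a + 1 / 8 - D (σ a)) (by linarith),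
        max_eq_left (a := 0) (b := D a + 1 / 4 - D k) (by linarith),
        max_eq_left (a := 0) (b := D a + 1 / 8 - D k) (by linarith)]
      linarith
  · rcases le_total (D (σ b)) (D b - 1 / 8) with h' | h'
    · refine ⟨b, k, D b - 1 / 8, D b - 1 / 24, by linarith, by linarith, by linarith, ?_⟩
      rw [← hk, max_eq_left (a := 0) (b := D b - 1 / 24 - D b) (by linarith),
        max_eq_left (a := 0) (b := D b - 1 / 8 - D b) (by linarith),
        max_eq_right (a := 0) (b := D b - 1 / 24 - D (σ b)) (by linarith),
        max_eq_right (a := 0) (b := D b - 1 / 8 - D (σ b)) (by linarith),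
        max_eq_right (a := 0) (b := D b - 1 / 24 - D k) (by linarith),
        max_eq_right (a := 0) (b := D b - 1 / 8 - D k) (by linarith)]
      linarith
    · refine ⟨b, k, D b - 1 / 4, D b - 1 / 8, by linarith, by linarith, by linarith, ?_⟩
      rw [← hk, max_eq_left (a := 0) (b := D b - 1 / 8 - D b) (by linarith),
        max_eq_left (a := 0) (b := D b - 1 / 4 - D b) (by linarith),
        max_eq_left (a := 0) (b := D b - 1 / 8 - D (σ b)) (by linarith),
        max_eq_left (a := 0) (b := D b - 1 / 4 - D (σ b)) (by linarith),
        max_eq_right (a := 0) (b := D b - 1 / 8 - D k) (by linarith),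
        max_eq_right (a := 0) (b := D b - 1 / 4 - D k) (by linarith)]
      linarith

theorem pairSum_triple {M : Type*} [MetricSpace M] [DecidableEq M] {x y z : M} (hxy : x ≠ y)
    (hxz : x ≠ z) (hyz : y ≠ z) :
    pairSum ({x, y, z} : Finset M) = dist x y + dist x z + dist y z := by
  have h : ∀ g : M → ℝ, ∑ w ∈ ({x, y, z} : Finset M), g w = g x + g y + g z := fun g => by
    rw [Finset.sum_insert (by simp [hxy, hxz]), Finset.sum_pair hyz]
    ring
  rw [pairSum, h, h, h, h, dist_comm y x, dist_comm z x, dist_comm z y]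
  simp only [dist_self]
  ring

open Classical in
/-- Two antipodal pairs of an isometric circle, together with two points of a segment outside the
circle, violate the six-point inequality of negative type, if the distances to the ends of the
segment compare differently at two points of the circle. -/
theorem exists_six_points {L : ℝ} (hL : 0 < L) {c : AddCircle L → G.Point} (hc : Isometry c)
    {f : G.E} (hf : ∀ θ (t : G.Segment f), 0 < (t : ℝ) → (t : ℝ) < G.len f → c θ ≠ G.onEdge f t)
    {p q : AddCircle L}
    (hpq : 1 ≤ (dist (G.vertex (G.src f)) (c q) - dist (G.vertex (G.tgt f)) (c q)) -
        (dist (G.vertex (G.src f)) (c p) - dist (G.vertex (G.tgt f)) (c p))) :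
    ∃ R B : Finset G.Point, R.card = 3 ∧ B.card = 3 ∧ Disjoint R B ∧
      1 / 12 ≤ pairSum R + pairSum B - ∑ x ∈ R, ∑ y ∈ B, dist x y := by
  have : Fact (0 < L) := ⟨hL⟩
  set α : AddCircle L → ℝ := fun θ => dist (G.vertex (G.src f)) (c θ) with hα
  set β : AddCircle L → ℝ := fun θ => dist (G.vertex (G.tgt f)) (c θ) with hβ
  set ℓ := G.len f with hℓ
  have hαβ : ∀ θ, |α θ - β θ| ≤ ℓ := fun θ =>
    (abs_dist_sub_le _ _ _).trans (dist_src_tgt_le f)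
  have hcont := hc.continuous
  let D : AddCircle L → ℝ := fun θ => (β θ - α θ + ℓ) / 2
  have hDc : Continuous D := by
    simp only [D, hα, hβ]
    fun_prop
  let σ : AddCircle L → AddCircle L := fun θ => θ + (L / 2 : ℝ)
  have hσσ : ∀ θ, σ (σ θ) = θ := fun θ => by
    simp only [σ]
    rw [add_assoc, ← AddCircle.coe_add, add_halves, AddCircle.coe_period, add_zero]
  have hσne : ∀ θ, dist θ (σ θ) = L / 2 := fun θ => by
    simp only [σ]
    rw [dist_eq_norm, sub_add_cancel_left, norm_neg, AddCircle.norm_half_period_eq,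
      abs_of_pos hL]
  have hσd : ∀ θ η, dist θ η + dist θ (σ η) ≤ L / 2 := fun θ η => by
    have := norm_add_norm_add_half_le hL (η - θ)
    rw [dist_comm, dist_comm θ, dist_eq_norm, dist_eq_norm]
    simp only [σ]
    rwa [add_sub_right_comm]
  obtain ⟨θ, η, s₁, s₂, hs₁, hs, hs₂, hgap⟩ := exists_levelSum_gap (σ := σ) (D := D) (ℓ := ℓ)
    (by simp only [σ]; fun_prop) hσσ hDc
    (fun θ => by simp only [D]; linarith [(abs_le.1 (hαβ θ)).2])
    (fun θ => by simp only [D]; linarith [(abs_le.1 (hαβ θ)).1])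
    (p := q) (q := p) (by simp only [D]; linarith)
  let y : ∀ s, 0 < s → s < ℓ → G.Point := fun s h h' => G.onEdge f ⟨s, h.le, h'.le⟩
  have hyd : ∀ s h h' θ, dist (c θ) (y s h h') = α θ + s - 2 * max 0 (s - D θ) := by
    intro s h h' θ
    rw [dist_comm, dist_onEdge_eq_min f _ _ (hf θ)]
    change min (s + α θ) (ℓ - s + β θ) = _
    simp only [D]
    rcases le_total s ((β θ - α θ + ℓ) / 2) with h | h
    · rw [max_eq_left (by linarith), min_eq_left (by linarith)]
      ring
    · rw [max_eq_right (by linarith), min_eq_right (by linarith)]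
      ring
  have hyy : dist (y s₂ (hs₁.trans hs) hs₂) (y s₁ hs₁ (hs.trans hs₂)) ≤ s₂ - s₁ :=
    (dist_onEdge_le _ _ _).trans (abs_of_pos (sub_pos.2 hs)).le
  have hcy : ∀ s h h' θ, c θ ≠ y s h h' := fun s h h' θ => hf θ _ h h'
  have hci : ∀ {θ η}, θ ≠ η → c θ ≠ c η := fun h h' => h (hc.injective h')
  have hθσ : ∀ θ, θ ≠ σ θ := fun θ h => by
    have := hσne θ
    rw [← h, dist_self] at this
    linarith
  -- Equal antipodal pairs have equal level sums, so the two pairs are disjoint.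
  have hne : θ ≠ η := by
    rintro rfl
    linarith
  have hne' : θ ≠ σ η := by
    rintro rfl
    simp only [levelSum, hσσ] at hgap
    linarith
  have hne₂ : σ θ ≠ η := fun h => hne' (by rw [← h, hσσ])
  have hne₃ : σ θ ≠ σ η := fun h => hne (by rw [← hσσ θ, h, hσσ])
  set z := y s₂ (hs₁.trans hs) hs₂ with hz
  set w := y s₁ hs₁ (hs.trans hs₂) with hw
  have hzd := hyd s₂ (hs₁.trans hs) hs₂
  have hwd := hyd s₁ hs₁ (hs.trans hs₂)
  rw [← hz] at hzd
  rw [← hw] at hwd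
  have hcz : ∀ θ, c θ ≠ z := hcy s₂ (hs₁.trans hs) hs₂
  have hcw : ∀ θ, c θ ≠ w := hcy s₁ hs₁ (hs.trans hs₂)
  have hzw : z ≠ w := fun h => by
    have h₁ := hzd θ
    have h₂ := hzd (σ θ)
    have h₃ := hzd η
    have h₄ := hzd (σ η)
    rw [h, hwd] at h₁ h₂ h₃ h₄
    simp only [levelSum] at hgap
    linarith
  refine ⟨{c θ, c (σ θ), z}, {c η, c (σ η), w}, ?_, ?_, ?_, ?_⟩
  · exact Finset.card_eq_three.2 ⟨_, _, _, hci (hθσ θ), hcz _, hcz _, rfl⟩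
  · exact Finset.card_eq_three.2 ⟨_, _, _, hci (hθσ η), hcw _, hcw _, rfl⟩
  · simp [hc.injective.eq_iff, hne.symm, hne'.symm, hne₂.symm, hne₃.symm, hcz, (hcw _).symm,
      hzw.symm]
  · rw [pairSum_triple (hci (hθσ θ)) (hcz _) (hcz _), pairSum_triple (hci (hθσ η)) (hcw _) (hcw _)]
    have h : ∀ {x y z : G.Point} (g : G.Point → ℝ), x ≠ y → x ≠ z → y ≠ z →
        ∑ w ∈ ({x, y, z} : Finset G.Point), g w = g x + g y + g z := fun g hxy hxz hyz => by
      rw [Finset.sum_insert (by simp [hxy, hxz]), Finset.sum_pair hyz]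
      ring
    rw [h _ (hci (hθσ θ)) (hcz _) (hcz _)]
    simp only [h _ (hci (hθσ η)) (hcw _) (hcw _)]
    rw [dist_comm z (c η), dist_comm z (c (σ η))]
    simp only [hzd, hwd, hc.dist_eq, hσne]
    have d₁ := hσd θ η
    have d₂ := hσd (σ θ) η
    simp only [levelSum] at hgap
    linarith

/-! ### Connectedness properties of the theta graph -/

/-- No gluing takes place at an interior point of a segment. -/
theorem exists_indicator_onEdge {e : G.E} {s : G.Segment e} (h₀ : 0 < (s : ℝ))
    (h₁ : (s : ℝ) < G.len e) : ∃ g : G.Point → Prop, g (G.onEdge e s) ∧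
      (∀ a, ¬ g (G.vertex a)) ∧ ∀ f t, g (G.onEdge f t) → f = e ∧ (t : ℝ) = s := by
  refine ⟨glueLift (fun _ => False) (fun f t => f = e ∧ (t : ℝ) = s) (fun f => ?_) (fun f => ?_),
    ⟨rfl, rfl⟩, fun _ h => h, fun _ _ h => h⟩
  · simp only [Segment.first, eq_iff_iff, iff_false, not_and]
    intro _
    exact h₀.ne
  · simp only [Segment.last, eq_iff_iff, iff_false, not_and]
    rintro rfl
    exact h₁.ne'

theorem eq_of_onEdge_eq {e f : G.E} {s : G.Segment e} {t : G.Segment f} (h₀ : 0 < (s : ℝ))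
    (h₁ : (s : ℝ) < G.len e) (h : G.onEdge e s = G.onEdge f t) : f = e ∧ (t : ℝ) = s := by
  obtain ⟨g, hg, -, hg'⟩ := exists_indicator_onEdge h₀ h₁
  exact hg' f t (h ▸ hg)

theorem onEdge_ne_vertex {e : G.E} {s : G.Segment e} (h₀ : 0 < (s : ℝ))
    (h₁ : (s : ℝ) < G.len e) (a : G.V) : G.onEdge e s ≠ G.vertex a := by
  intro h
  obtain ⟨g, hg, hg', -⟩ := exists_indicator_onEdge h₀ h₁
  exact hg' a (h ▸ hg)

theorem vertex_injective : Function.Injective G.vertex := by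
  intro a b h
  obtain ⟨l, hl, hd⟩ := exists_isWalk_dist a b
  rw [h, dist_self] at hd
  cases hl with
  | nil => rfl
  | cons _ _ =>
    rename_i e l _ _
    rw [walkLength_cons] at hd
    linarith [G.len_pos e, walkLength_nonneg l]

variable (G) in
/-- A segment, extended to the real line by constants. -/
noncomputable def edgePath (e : G.E) (t : ℝ) : G.Point :=
  G.onEdge e (projIcc 0 (G.len e) (G.len_pos e).le t)

theorem continuous_edgePath (e : G.E) : Continuous (G.edgePath e) :=
  (continuous_onEdge e).comp continuous_projIcc

theorem edgePath_coe (e : G.E) (t : G.Segment e) : G.edgePath e t = G.onEdge e t := by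
  rw [edgePath, projIcc_val]

theorem edgePath_zero (e : G.E) : G.edgePath e 0 = G.vertex (G.src e) := by
  rw [← onEdge_first]
  exact edgePath_coe e (Segment.first G e)

theorem edgePath_len (e : G.E) : G.edgePath e (G.len e) = G.vertex (G.tgt e) := by
  rw [← onEdge_last]
  exact edgePath_coe e (Segment.last G e)

theorem isPreconnected_edgePath (e : G.E) (a b : ℝ) :
    IsPreconnected (G.edgePath e '' Icc a b) :=
  isPreconnected_Icc.image _ (continuous_edgePath e).continuousOn

theorem exists_edgePath_eq (ℓ : Fin 3 → ℝ) (hℓ : ∀ i, 0 < ℓ i) (x : (theta ℓ hℓ).Point) :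
    ∃ i, ∃ t ∈ Icc 0 (ℓ i), x = (theta ℓ hℓ).edgePath i t := by
  rcases (theta ℓ hℓ).point_cases x with ⟨a, rfl⟩ | ⟨i, t, -, -, rfl⟩
  · cases a
    · exact ⟨0, 0, ⟨le_rfl, (hℓ 0).le⟩, (edgePath_zero (G := theta ℓ hℓ) (0 : Fin 3)).symm⟩
    · exact ⟨0, ℓ 0, ⟨(hℓ 0).le, le_rfl⟩, (edgePath_len (G := theta ℓ hℓ) (0 : Fin 3)).symm⟩
  · exact ⟨i, t, t.2, (edgePath_coe (G := theta ℓ hℓ) i t).symm⟩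

/-- A theta graph stays connected when at most one point is removed from each of two edges. -/
theorem isPreconnected_theta_compl {ℓ : Fin 3 → ℝ} {hℓ : ∀ i, 0 < ℓ i}
    {Z : Set (theta ℓ hℓ).Point} (k : Fin 3)
    (hk : ∀ t ∈ Icc 0 (ℓ k), (theta ℓ hℓ).edgePath k t ∉ Z)
    (hZ : ∀ i, ∀ s ∈ Icc 0 (ℓ i), ∀ t ∈ Icc 0 (ℓ i), (theta ℓ hℓ).edgePath i s ∈ Z →
      (theta ℓ hℓ).edgePath i t ∈ Z → s = t) : IsPreconnected Zᶜ := by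
  have z : ∀ i, (theta ℓ hℓ).edgePath i 0 = (theta ℓ hℓ).vertex false :=
    edgePath_zero (G := theta ℓ hℓ)
  have o : ∀ i, (theta ℓ hℓ).edgePath i (ℓ i) = (theta ℓ hℓ).vertex true :=
    edgePath_len (G := theta ℓ hℓ)
  refine isPreconnected_of_forall ((theta ℓ hℓ).vertex false) ?_
  intro y hy
  obtain ⟨i, t, ht, rfl⟩ := exists_edgePath_eq ℓ hℓ y
  by_cases h : ∃ s ∈ Icc 0 t, (theta ℓ hℓ).edgePath i s ∈ Z
  · obtain ⟨s, hs, hsZ⟩ := h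
    refine ⟨(theta ℓ hℓ).edgePath i '' Icc t (ℓ i) ∪ (theta ℓ hℓ).edgePath k '' Icc 0 (ℓ k),
      ?_, ?_, ?_, ?_⟩
    · rintro _ (⟨r, hr, rfl⟩ | ⟨r, hr, rfl⟩)
      · intro hrZ
        have := hZ i s ⟨hs.1, hs.2.trans ht.2⟩ r ⟨ht.1.trans hr.1, hr.2⟩ hsZ hrZ
        have hst : s = t := le_antisymm hs.2 (this ▸ hr.1)
        exact hy (hst ▸ hsZ)
      · exact hk r hr
    · exact Or.inr ⟨0, ⟨le_rfl, (hℓ k).le⟩, z k⟩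
    · exact Or.inl ⟨t, ⟨le_rfl, ht.2⟩, rfl⟩
    · exact (isPreconnected_edgePath (G := theta ℓ hℓ) i _ _).union _
        ⟨ℓ i, ⟨ht.2, le_rfl⟩, o i⟩ ⟨ℓ k, ⟨(hℓ k).le, le_rfl⟩, o k⟩
        (isPreconnected_edgePath (G := theta ℓ hℓ) k _ _)
  · push Not at h
    refine ⟨(theta ℓ hℓ).edgePath i '' Icc 0 t, ?_, ?_, ?_, ?_⟩
    · rintro _ ⟨r, hr, rfl⟩
      exact h r hr
    · exact ⟨0, ⟨le_rfl, ht.1⟩, z i⟩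
    · exact ⟨t, ⟨ht.1, le_rfl⟩, rfl⟩
    · exact isPreconnected_edgePath (G := theta ℓ hℓ) i _ _

theorem edgePath_interior_inj {e f : G.E} {s t : ℝ} (hs : s ∈ Ioo 0 (G.len e))
    (ht : t ∈ Icc 0 (G.len f)) (h : G.edgePath e s = G.edgePath f t) : f = e ∧ t = s := by
  have e₁ := edgePath_coe e ⟨s, Ioo_subset_Icc_self hs⟩
  have e₂ := edgePath_coe f ⟨t, ht⟩
  simp only at e₁ e₂
  rw [e₁, e₂] at h
  exact eq_of_onEdge_eq (s := ⟨s, _⟩) hs.1 hs.2 h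

theorem edgePath_ne_vertex {e : G.E} {s : ℝ} (hs : s ∈ Ioo 0 (G.len e)) (a : G.V) :
    G.edgePath e s ≠ G.vertex a := by
  have e₁ := edgePath_coe e ⟨s, Ioo_subset_Icc_self hs⟩
  simp only at e₁
  rw [e₁]
  exact onEdge_ne_vertex (s := ⟨s, _⟩) hs.1 hs.2 a

/-- A theta graph stays connected when interior points of two different edges are removed. -/
theorem isPreconnected_theta_compl_pair {ℓ : Fin 3 → ℝ} {hℓ : ∀ i, 0 < ℓ i} {i j : Fin 3} {s t : ℝ}
    (hij : i ≠ j) (hs : s ∈ Ioo 0 (ℓ i)) (ht : t ∈ Ioo 0 (ℓ j)) :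
    IsPreconnected ({(theta ℓ hℓ).edgePath i s, (theta ℓ hℓ).edgePath j t}ᶜ : Set _) := by
  have inj₁ := fun m r hr => edgePath_interior_inj (G := theta ℓ hℓ) (e := i) (f := m)
    (t := r) hs hr
  have inj₂ := fun m r hr => edgePath_interior_inj (G := theta ℓ hℓ) (e := j) (f := m)
    (t := r) ht hr
  obtain ⟨k, hki, hkj⟩ : ∃ k, k ≠ i ∧ k ≠ j := by
    exact (by decide : ∀ i j : Fin 3, ∃ k, k ≠ i ∧ k ≠ j) i j
  refine isPreconnected_theta_compl k ?_ ?_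
  · rintro r hr (h | h)
    · exact hki (inj₁ k r hr h.symm).1
    · exact hkj (inj₂ k r hr h.symm).1
  · rintro m r hr r' hr' (h | h) (h' | h')
    · rw [(inj₁ m r hr h.symm).2, (inj₁ m r' hr' h'.symm).2]
    · exact absurd ((inj₁ m r hr h.symm).1.symm.trans (inj₂ m r' hr' h'.symm).1) hij
    · exact absurd ((inj₁ m r' hr' h'.symm).1.symm.trans (inj₂ m r hr h.symm).1) hij
    · rw [(inj₂ m r hr h.symm).2, (inj₂ m r' hr' h'.symm).2]

/-- A theta graph has no cut point. -/
theorem isPreconnected_theta_compl_singleton {ℓ : Fin 3 → ℝ} {hℓ : ∀ i, 0 < ℓ i}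
    (x : (theta ℓ hℓ).Point) : IsPreconnected ({x}ᶜ : Set _) := by
  have z : ∀ i, (theta ℓ hℓ).edgePath i 0 = (theta ℓ hℓ).vertex false :=
    edgePath_zero (G := theta ℓ hℓ)
  have o : ∀ i, (theta ℓ hℓ).edgePath i (ℓ i) = (theta ℓ hℓ).vertex true :=
    edgePath_len (G := theta ℓ hℓ)
  have hne : (theta ℓ hℓ).vertex false ≠ (theta ℓ hℓ).vertex true := fun h =>
    Bool.false_ne_true (vertex_injective (G := theta ℓ hℓ) h)
  rcases (theta ℓ hℓ).point_cases x with ⟨a, rfl⟩ | ⟨i, s, hs₀, hs₁, rfl⟩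
  · cases a
    · refine isPreconnected_of_forall ((theta ℓ hℓ).vertex true) ?_
      intro y hy
      obtain ⟨i, t, ht, rfl⟩ := exists_edgePath_eq ℓ hℓ y
      refine ⟨(theta ℓ hℓ).edgePath i '' Icc t (ℓ i), ?_, ⟨_, ⟨ht.2, le_rfl⟩, o i⟩,
        ⟨t, ⟨le_rfl, ht.2⟩, rfl⟩, isPreconnected_edgePath (G := theta ℓ hℓ) i _ _⟩
      rintro _ ⟨r, hr, rfl⟩ h
      rcases (ht.1.trans hr.1).eq_or_lt with h₀ | h₀
      · exact hy (by rw [le_antisymm (hr.1.trans h₀.ge) ht.1]; exact z i)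
      · rcases hr.2.eq_or_lt with h₁ | h₁
        · rw [h₁] at h
          exact hne (h.symm.trans (o i))
        · exact edgePath_ne_vertex (G := theta ℓ hℓ) (e := i) ⟨h₀, h₁⟩ _ h
    · refine isPreconnected_of_forall ((theta ℓ hℓ).vertex false) ?_
      intro y hy
      obtain ⟨i, t, ht, rfl⟩ := exists_edgePath_eq ℓ hℓ y
      refine ⟨(theta ℓ hℓ).edgePath i '' Icc 0 t, ?_, ⟨_, ⟨le_rfl, ht.1⟩, z i⟩,
        ⟨t, ⟨ht.1, le_rfl⟩, rfl⟩, isPreconnected_edgePath (G := theta ℓ hℓ) i _ _⟩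
      rintro _ ⟨r, hr, rfl⟩ h
      rcases (hr.2.trans ht.2).eq_or_lt with h₁ | h₁
      · exact hy (by rw [le_antisymm ht.2 (h₁.ge.trans hr.2)]; exact o i)
      · rcases hr.1.eq_or_lt with h₀ | h₀
        · rw [← h₀] at h
          exact hne ((z i).symm.trans h)
        · exact edgePath_ne_vertex (G := theta ℓ hℓ) (e := i) ⟨h₀, h₁⟩ _ h
  · have inj := fun m r hr => edgePath_interior_inj (G := theta ℓ hℓ) (e := i) (f := m) (s := s)
      (t := r) ⟨hs₀, hs₁⟩ hr
    rw [edgePath_coe] at inj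
    obtain ⟨k, hki⟩ : ∃ k, k ≠ i := by
      exact (by decide : ∀ i : Fin 3, ∃ k, k ≠ i) i
    refine isPreconnected_theta_compl k ?_ ?_
    · intro r hr h
      exact hki (inj k r hr h.symm).1
    · intro m r hr r' hr' h h'
      rw [(inj m r hr h.symm).2, (inj m r' hr' h'.symm).2]

/-! ### The image of a theta graph -/

open Classical in
/-- A function that vanishes outside the interior of one segment. -/
theorem exists_continuous_bump (e : G.E) {g : ℝ → ℝ} (hg : Continuous g) (h₀ : g 0 = 0)
    (h₁ : g (G.len e) = 0) : ∃ φ : G.Point → ℝ, Continuous φ ∧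
      (∀ t : G.Segment e, φ (G.onEdge e t) = g t) ∧ (∀ a, φ (G.vertex a) = 0) ∧
      ∀ f ≠ e, ∀ t : G.Segment f, φ (G.onEdge f t) = 0 := by
  let φ : G.Point → ℝ := glueLift (fun _ => 0) (fun f t => if f = e then g t else 0)
    (fun f => by
      split_ifs
      · exact h₀
      · rfl)
    (fun f => by
      split_ifs with h
      · subst h
        exact h₁
      · rfl)
  refine ⟨φ, continuous_of_continuous_onEdge fun f => ?_, fun t => if_pos rfl, fun _ => rfl,
    fun f hf t => if_neg hf⟩
  change Continuous fun s : G.Segment f => if f = e then g s else 0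
  split_ifs
  · fun_prop
  · exact continuous_const

/-- An injective path runs through a whole interval of some segment. -/
theorem exists_subset_range {ℓ : Fin 3 → ℝ} {hℓ : ∀ i, 0 < ℓ i} {F : (theta ℓ hℓ).Point → G.Point}
    (hF : Continuous F) (hinj : Function.Injective F) (i : Fin 3) :
    ∃ (e : G.E) (p₁ p p₂ : G.Segment e), 0 < (p₁ : ℝ) ∧ (p₁ : ℝ) < p ∧ (p : ℝ) < p₂ ∧
      (p₂ : ℝ) < G.len e ∧ (∀ t : G.Segment e, (p₁ : ℝ) ≤ t → (t : ℝ) ≤ p₂ →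
        G.onEdge e t ∈ range F) ∧
      ∃ s ∈ Ioo 0 (ℓ i), F ((theta ℓ hℓ).edgePath i s) = G.onEdge e p := by
  have := G.finV
  let h : ℝ → G.Point := fun s => F ((theta ℓ hℓ).edgePath i s)
  have hc : Continuous h := hF.comp (continuous_edgePath (G := theta ℓ hℓ) i)
  have hi : InjOn h (Ioo 0 (ℓ i)) := fun s hs t ht hst =>
    (edgePath_interior_inj (G := theta ℓ hℓ) (e := i) (f := i) hs (Ioo_subset_Icc_self ht)
      (hinj hst)).2.symm
  obtain ⟨_, ⟨s, hs, rfl⟩, hsv⟩ := ((Ioo_infinite (hℓ i)).image hi).exists_notMem_finite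
    (finite_range G.vertex)
  rcases G.point_cases (h s) with ⟨a, ha⟩ | ⟨e, t₀, h₀, h₁, hst⟩
  · exact absurd ⟨a, ha.symm⟩ hsv
  -- `B` is positive exactly near `h s`, and `T` is the coordinate of the segment there.
  obtain ⟨ε, hε, hε₀, hε₁⟩ : ∃ ε > 0, ε < (t₀ : ℝ) ∧ ε < G.len e - t₀ :=
    ⟨min (t₀ : ℝ) (G.len e - t₀) / 2, half_pos (lt_min h₀ (by linarith)),
      by linarith [min_le_left (t₀ : ℝ) (G.len e - t₀)],
      by linarith [min_le_right (t₀ : ℝ) (G.len e - t₀)]⟩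
  obtain ⟨B, hBc, hBe, hBv, hBf⟩ := exists_continuous_bump e (g := fun t => max 0 (ε - |t - t₀|))
    (by fun_prop)
    (by
      rw [zero_sub, abs_neg, abs_of_pos h₀]
      exact max_eq_left (by linarith))
    (by
      rw [abs_of_pos (by linarith)]
      exact max_eq_left (by linarith))
  obtain ⟨T, hTc, hTe, -, -⟩ := exists_continuous_bump e
    (g := fun t => min t ((G.len e / (G.len e - t₀ - ε)) * (G.len e - t))) (by fun_prop)
    (by
      rw [sub_zero]
      exact min_eq_left (mul_nonneg (div_nonneg (G.len_pos e).le (by linarith)) (G.len_pos e).le))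
    (by
      rw [sub_self, mul_zero]
      exact min_eq_right (G.len_pos e).le)
  have hBT : ∀ x, 0 < B x → ∃ t : G.Segment e, x = G.onEdge e t ∧ T x = t ∧
      0 < (t : ℝ) ∧ (t : ℝ) < G.len e := by
    intro x hx
    rcases G.point_cases x with ⟨a, rfl⟩ | ⟨f, t, ht₀, ht₁, rfl⟩
    · exact absurd (hBv a) hx.ne'
    · by_cases hf : f = e
      · subst hf
        refine ⟨t, rfl, ?_, ht₀, ht₁⟩
        rw [hBe, lt_max_iff] at hx
        have hx' := abs_lt.1 (sub_pos.1 (hx.resolve_left (lt_irrefl _)))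
        rw [hTe]
        apply min_eq_left
        rw [div_mul_eq_mul_div, le_div_iff₀ (by linarith), mul_comm]
        have hle : G.len f - t₀ - ε ≤ G.len f - t := by linarith
        calc (G.len f - t₀ - ε) * t ≤ (G.len f - t) * t := by gcongr
          _ ≤ (G.len f - t) * G.len f := mul_le_mul_of_nonneg_left ht₁.le (by linarith)
          _ = G.len f * (G.len f - t) := mul_comm _ _
      · exact absurd (hBf f hf t) hx.ne'
  have hopen : IsOpen (Ioo 0 (ℓ i) ∩ {r | 0 < B (h r)}) :=
    isOpen_Ioo.inter (isOpen_lt continuous_const (hBc.comp hc))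
  have hmem : s ∈ Ioo 0 (ℓ i) ∩ {r | 0 < B (h r)} := by
    refine ⟨hs, ?_⟩
    change 0 < B (h s)
    rw [hst, hBe]
    simp [hε]
  obtain ⟨δ, hδ, hball⟩ := Metric.isOpen_iff.1 hopen s hmem
  have hI : ∀ r ∈ uIcc s (s + δ / 2), r ∈ Ioo 0 (ℓ i) ∧ 0 < B (h r) := fun r hr => hball (by
    rw [uIcc_of_le (by linarith)] at hr
    rw [Metric.mem_ball, Real.dist_eq, abs_of_nonneg (by linarith [hr.1])]
    linarith [hr.2])
  obtain ⟨t₁, ht₁, hT₁, ht₁0, ht₁1⟩ := hBT _ (hI s left_mem_uIcc).2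
  obtain ⟨t₂, ht₂, hT₂, ht₂0, ht₂1⟩ := hBT _ (hI (s + δ / 2) right_mem_uIcc).2
  have hne : (t₁ : ℝ) ≠ t₂ := by
    intro heq
    have := hi (hI s left_mem_uIcc).1 (hI (s + δ / 2) right_mem_uIcc).1
      (by rw [ht₁, ht₂, Subtype.ext heq])
    linarith
  have hivt := intermediate_value_uIcc (f := fun r => T (h r)) (a := s) (b := s + δ / 2)
    (hTc.comp hc).continuousOn
  rw [hT₁, hT₂] at hivt
  have hrange : ∀ t : G.Segment e, (t : ℝ) ∈ uIcc (t₁ : ℝ) t₂ →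
      ∃ r ∈ Ioo 0 (ℓ i), h r = G.onEdge e t := by
    intro t ht
    obtain ⟨r, hr, hrt⟩ := hivt ht
    obtain ⟨t', ht', hT', -, -⟩ := hBT _ (hI r hr).2
    refine ⟨r, (hI r hr).1, ?_⟩
    rw [ht']
    exact congrArg _ (Subtype.ext (hT'.symm.trans hrt))
  obtain ⟨p₁, p₂, hp0, hp, hp1, hpu⟩ : ∃ p₁ p₂ : G.Segment e, 0 < (p₁ : ℝ) ∧ (p₁ : ℝ) < p₂ ∧
      (p₂ : ℝ) < G.len e ∧ uIcc (t₁ : ℝ) t₂ = Icc (p₁ : ℝ) p₂ := by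
    rcases hne.lt_or_gt with hlt | hlt
    · exact ⟨t₁, t₂, ht₁0, hlt, ht₂1, uIcc_of_le hlt.le⟩
    · exact ⟨t₂, t₁, ht₂0, hlt, ht₁1, uIcc_of_ge hlt.le⟩
  rw [hpu] at hrange
  refine ⟨e, p₁, ⟨((p₁ : ℝ) + p₂) / 2, by linarith, by linarith⟩, p₂, hp0, ?_, ?_, hp1,
    fun t h₁ h₂ => ?_, ?_⟩
  · change (p₁ : ℝ) < ((p₁ : ℝ) + p₂) / 2
    linarith
  · change ((p₁ : ℝ) + p₂) / 2 < (p₂ : ℝ)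
    linarith
  · obtain ⟨r, -, hr⟩ := hrange t ⟨h₁, h₂⟩
    exact ⟨_, hr⟩
  · refine hrange _ ⟨?_, ?_⟩
    · change (p₁ : ℝ) ≤ ((p₁ : ℝ) + p₂) / 2
      linarith
    · change ((p₁ : ℝ) + p₂) / 2 ≤ (p₂ : ℝ)
      linarith

/-! ### From connectedness to walks and ears -/

theorem not_pos_neg_of_isPreconnected {X : Set G.Point} (hX : IsPreconnected X) {φ : G.Point → ℝ}
    (hφ : Continuous φ) (h₀ : ∀ x ∈ X, φ x ≠ 0) {x y : G.Point} (hx : x ∈ X) (hy : y ∈ X)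
    (hxn : φ x < 0) (hyp : 0 < φ y) : False := by
  obtain ⟨z, hz, hz0⟩ := hX.intermediate_value hx hy hφ.continuousOn ⟨hxn.le, hyp.le⟩
  exact h₀ z hz hz0

/-- A continuous function that rises from `-1` to `1` on `[0, ℓ]`, with its only zero at `m`. -/
theorem exists_crossing {m ℓ : ℝ} (h₀ : 0 < m) (h₁ : m < ℓ) : ∃ g : ℝ → ℝ, Continuous g ∧
    g 0 = -1 ∧ g ℓ = 1 ∧ (∀ t, g t < 0 ↔ t < m) ∧ ∀ t, 0 < g t ↔ m < t := by
  have h₂ : 0 < ℓ - m := by linarith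
  have hN : 0 < 1 / m + 1 / (ℓ - m) := by positivity
  refine ⟨fun t => max (-1) (min 1 ((1 / m + 1 / (ℓ - m)) * (t - m))), by fun_prop, ?_, ?_,
    fun t => ?_, fun t => ?_⟩
  · have : (1 / m + 1 / (ℓ - m)) * (0 - m) ≤ -1 := by
      have e : (1 / m + 1 / (ℓ - m)) * (0 - m) = -1 - m / (ℓ - m) := by
        field_simp
        ring
      rw [e]
      linarith [div_pos h₀ h₂]
    exact max_eq_left ((min_le_right _ _).trans this)
  · have : 1 ≤ (1 / m + 1 / (ℓ - m)) * (ℓ - m) := by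
      have e : (1 / m + 1 / (ℓ - m)) * (ℓ - m) = (ℓ - m) / m + 1 := by
        field_simp
      rw [e]
      linarith [div_pos h₂ h₀]
    simp only [min_eq_left this]
    norm_num
  · simp only [max_lt_iff, min_lt_iff, mul_neg_iff, hN, hN.not_gt]
    norm_num
  · simp only [lt_max_iff, lt_min_iff, mul_pos_iff, hN, hN.not_gt]
    norm_num

open Classical in
/-- If a connected set misses a point of each edge in `Z`, and meets an edge in `Z` on both sides of
the missing point, then the ends of that edge are joined by a walk that avoids `Z`. -/
theorem exists_isWalk_of_isPreconnected {X : Set G.Point} (hX : IsPreconnected X) {Z : Set G.E}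
    {m : G.E → ℝ} (hm : ∀ f ∈ Z, 0 < m f ∧ m f < G.len f)
    (hXm : ∀ f ∈ Z, ∀ t : G.Segment f, (t : ℝ) = m f → G.onEdge f t ∉ X) {e : G.E} (he : e ∈ Z)
    {p q : G.Segment e} (hp : G.onEdge e p ∈ X) (hq : G.onEdge e q ∈ X) (hpm : (p : ℝ) < m e)
    (hmq : m e < q) : ∃ l, G.IsWalk (G.src e) l (G.tgt e) ∧ ∀ f ∈ l, f ∉ Z := by
  by_contra hcon
  -- A function with the sign `-1` at the vertices reachable from `src e`, and `1` at the others,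
  -- that is constant outside `Z` and changes sign on edges in `Z` at the missing points only.
  let S : Set G.V := {y | ∃ l, G.IsWalk (G.src e) l y ∧ ∀ f ∈ l, f ∉ Z}
  have hsrc : G.src e ∈ S := ⟨[], .nil _, by simp⟩
  have htgt : G.tgt e ∉ S := hcon
  have hstep : ∀ {f a b}, f ∉ Z → G.Joins f a b → a ∈ S → b ∈ S := by
    rintro f a b hf hj ⟨l, hl, hlZ⟩
    refine ⟨l ++ [f], hl.append hj.isWalk, ?_⟩
    simp only [List.mem_append, List.mem_singleton, or_imp, forall_and, forall_eq]
    exact ⟨hlZ, hf⟩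
  have hiff : ∀ f ∉ Z, G.src f ∈ S ↔ G.tgt f ∈ S := fun f hf =>
    ⟨hstep hf (Or.inl ⟨rfl, rfl⟩), hstep hf (Or.inr ⟨rfl, rfl⟩)⟩
  choose! g hgc hg0 hg1 hgn hgp using fun f hf => exists_crossing (hm f hf).1 (hm f hf).2
  let σ : G.V → ℝ := fun y => if y ∈ S then -1 else 1
  have hσ : ∀ y, σ y = -1 ∨ σ y = 1 := fun y => by
    simp only [σ]
    split_ifs <;> simp
  have hσne : ∀ y, σ y ≠ 0 := fun y => by rcases hσ y with h | h <;> rw [h] <;> norm_num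
  let ψ : ∀ f, G.Segment f → ℝ := fun f t =>
    if σ (G.src f) = σ (G.tgt f) then σ (G.src f) else σ (G.tgt f) * g f t
  have hZ : ∀ f, σ (G.src f) ≠ σ (G.tgt f) → f ∈ Z := fun f h => by
    by_contra hf
    exact h (by simp only [σ, hiff f hf])
  let φ : G.Point → ℝ := glueLift σ ψ
    (fun f => by
      simp only [ψ, Segment.first]
      split_ifs with h
      · rfl
      · rw [hg0 f (hZ f h), mul_neg_one]
        rcases hσ (G.src f) with h₁ | h₁ <;> rcases hσ (G.tgt f) with h₂ | h₂
        · exact absurd (h₁.trans h₂.symm) h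
        · rw [h₁, h₂]
        · rw [h₁, h₂, neg_neg]
        · exact absurd (h₁.trans h₂.symm) h)
    (fun f => by
      simp only [ψ, Segment.last]
      split_ifs with h
      · exact h
      · rw [hg1 f (hZ f h), mul_one])
  have hφc : Continuous φ := by
    refine continuous_of_continuous_onEdge fun f => ?_
    change Continuous (ψ f)
    simp only [ψ]
    split_ifs with h
    · exact continuous_const
    · exact continuous_const.mul ((hgc f (hZ f h)).comp continuous_subtype_val)
  have hφe : ∀ t, φ (G.onEdge e t) = g e t := fun t => by
    change ψ e t = _
    have h₁ : σ (G.src e) = -1 := if_pos hsrc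
    have h₂ : σ (G.tgt e) = 1 := if_neg htgt
    simp only [ψ, h₁, h₂, one_mul]
    rw [if_neg (by norm_num)]
  refine not_pos_neg_of_isPreconnected hX hφc ?_ hp hq ?_ ?_
  · intro x hx
    rcases G.point_cases x with ⟨a, rfl⟩ | ⟨f, t, -, -, rfl⟩
    · exact hσne a
    · change ψ f t ≠ 0
      simp only [ψ]
      split_ifs with h
      · exact hσne _
      · refine mul_ne_zero (hσne _) fun h0 => ?_
        have hf := hZ f h
        have h₁ := mt (hgn f hf t).2 (by rw [h0]; exact lt_irrefl _)
        have h₂ := mt (hgp f hf t).2 (by rw [h0]; exact lt_irrefl _)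
        exact hXm f hf t (le_antisymm (not_lt.1 h₂) (not_lt.1 h₁)) hx
  · rw [hφe]
    exact (hgn e he _).2 hpm
  · rw [hφe]
    exact (hgp e he _).2 hmq

/-- A connected set cannot lie on both sides of a pair of missing points of the same edge. -/
theorem false_of_isPreconnected {X : Set G.Point} (hX : IsPreconnected X) {e : G.E}
    {a b p q : G.Segment e} (ha : 0 < (a : ℝ)) (hab : (a : ℝ) < b) (hb : (b : ℝ) < G.len e)
    (haX : G.onEdge e a ∉ X) (hbX : G.onEdge e b ∉ X) (hp : G.onEdge e p ∈ X)
    (hq : G.onEdge e q ∈ X) (hap : (a : ℝ) < p) (hpb : (p : ℝ) < b)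
    (hq' : (q : ℝ) < a ∨ (b : ℝ) < q) : False := by
  have ha' : 0 < G.len e - a := by linarith
  have hb' : 0 < G.len e - b := by linarith
  have hb₀ : 0 < (b : ℝ) := by linarith
  -- The constant makes the quadratic at most `-1` at both ends of the segment.
  set K : ℝ := 1 / (a * b) + 1 / ((G.len e - a) * (G.len e - b)) with hK
  have hKpos : 0 < K := by positivity
  have h₀ : K * ((0 - a) * (b - 0)) ≤ -1 := by
    have : K * ((0 - a) * (b - 0)) = -1 - a * b / ((G.len e - a) * (G.len e - b)) := by
      rw [hK]
      field_simp
      ring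
    rw [this]
    have : 0 < (a : ℝ) * b / ((G.len e - a) * (G.len e - b)) := by positivity
    linarith
  have h₁ : K * ((G.len e - a) * (b - G.len e)) ≤ -1 := by
    have : K * ((G.len e - a) * (b - G.len e)) =
        -1 - (G.len e - a) * (G.len e - b) / (a * b) := by
      rw [hK]
      field_simp
      ring
    rw [this]
    have : 0 < (G.len e - a) * (G.len e - b) / ((a : ℝ) * b) := by positivity
    linarith
  obtain ⟨φ, hφ, hφe, hφv, hφf⟩ := exists_continuous_bump e
    (g := fun t => max (-1) (K * ((t - a) * (b - t))) + 1) (by fun_prop)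
    (by rw [max_eq_left h₀, neg_add_cancel]) (by rw [max_eq_left h₁, neg_add_cancel])
  refine not_pos_neg_of_isPreconnected hX (φ := fun x => φ x - 1) (by fun_prop) ?_ hq hp ?_ ?_
  · intro x hx
    rcases G.point_cases x with ⟨y, rfl⟩ | ⟨f, t, -, -, rfl⟩
    · simp [hφv]
    · by_cases hf : f = e
      · subst hf
        rw [hφe, add_sub_cancel_right]
        intro h
        rcases max_choice (-1) (K * ((t - a) * (b - t))) with h' | h'
        · rw [h'] at h
          norm_num at h
        · rw [h', mul_eq_zero, mul_eq_zero, sub_eq_zero, sub_eq_zero] at h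
          rcases h with h | h | h
          · exact hKpos.ne' h
          · exact haX (Subtype.ext h ▸ hx)
          · exact hbX (Subtype.ext h.symm ▸ hx)
      · simp [hφf f hf]
  · rw [hφe, add_sub_cancel_right]
    refine max_lt (by norm_num) (mul_neg_of_pos_of_neg hKpos ?_)
    rcases hq' with h | h
    · exact mul_neg_of_neg_of_pos (by linarith) (by linarith)
    · exact mul_neg_of_pos_of_neg (by linarith) (by linarith)
  · rw [hφe, add_sub_cancel_right]
    exact lt_max_of_lt_right (mul_pos hKpos (mul_pos (by linarith) (by linarith)))

/-- A walk that starts on the `P`-side of `C` and ends on the other side, without crossing over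
along an edge of `C`, contains an ear. -/
theorem exists_isEar_of_isWalk {C : Set G.E} {P : G.V → Prop} {x y : G.V} {l : List G.E}
    (h : G.IsWalk x l y) (hP : ∀ f ∈ l, f ∈ C → (P (G.src f) ↔ P (G.tgt f)))
    (hy : IsEndOf C y) (hyP : ¬ P y)
    (hx : ∃ u m, G.IsWalk u m x ∧ (∀ f ∈ m, f ∉ C) ∧ IsEndOf C u ∧ P u) :
    ∃ a l b, IsEar C a l b := by
  induction h with
  | nil x =>
    obtain ⟨u, m, hm, hmC, hu, huP⟩ := hx
    exact ⟨u, m, x, hm, hmC, hu, hy, fun h => hyP (h ▸ huP)⟩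
  | cons hj hw ih =>
    rename_i x x' y f l
    obtain ⟨u, m, hm, hmC, hu, huP⟩ := hx
    have ih' := ih (fun g hg => hP g (List.mem_cons_of_mem _ hg)) hy hyP
    by_cases hf : f ∈ C
    · by_cases hxP : P x
      · refine ih' ⟨x', [], .nil _, by simp, hj.symm.isEndOf_left hf, ?_⟩
        have := hP f List.mem_cons_self hf
        rcases hj with ⟨rfl, rfl⟩ | ⟨rfl, rfl⟩
        · exact this.1 hxP
        · exact this.2 hxP
      · exact ⟨u, m, x, hm, hmC, hu, hj.isEndOf_left hf, fun h => hxP (h ▸ huP)⟩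
    · refine ih' ⟨u, m ++ [f], hm.append hj.isWalk, ?_, hu, huP⟩
      simp only [List.mem_append, List.mem_singleton, or_imp, forall_and, forall_eq]
      exact ⟨hmC, hf⟩

open Classical in
/-- If a connected set contains points of the edge `g`, which is not in `C`, and of the edge `e` in
`C`, whichever vertex is removed from it, then `C` has an ear: otherwise the part of the graph that
hangs on `g` is attached to the rest at a single vertex. -/
theorem exists_isEar_of_notMem {C : Set G.E} {e g : G.E} (he : e ∈ C) (hg : g ∉ C)
    {p : G.Segment e} {q : G.Segment g} (hp : 0 < (p : ℝ) ∧ (p : ℝ) < G.len e)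
    (hq : 0 < (q : ℝ) ∧ (q : ℝ) < G.len g)
    (hX : ∀ a, ∃ X : Set G.Point, IsPreconnected X ∧ G.vertex a ∉ X ∧ G.onEdge e p ∈ X ∧
      G.onEdge g q ∈ X) : ∃ a l b, IsEar C a l b := by
  by_contra hcon
  let T : Set G.V := {y | ∃ l, G.IsWalk (G.src g) l y ∧ ∀ f ∈ l, f ∉ C}
  have hstep : ∀ {f a b}, f ∉ C → G.Joins f a b → a ∈ T → b ∈ T := by
    rintro f a b hf hj ⟨l, hl, hlC⟩
    refine ⟨l ++ [f], hl.append hj.isWalk, ?_⟩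
    simp only [List.mem_append, List.mem_singleton, or_imp, forall_and, forall_eq]
    exact ⟨hlC, hf⟩
  have hiff : ∀ f ∉ C, G.src f ∈ T ↔ G.tgt f ∈ T := fun f hf =>
    ⟨hstep hf (Or.inl ⟨rfl, rfl⟩), hstep hf (Or.inr ⟨rfl, rfl⟩)⟩
  obtain ⟨c, hc⟩ : ∃ c, ∀ y ∈ T, IsEndOf C y → y = c := by
    by_cases h : ∃ c ∈ T, IsEndOf C c
    · obtain ⟨c, ⟨l, hl, hlC⟩, hcC⟩ := h
      refine ⟨c, ?_⟩
      rintro y ⟨l', hl', hlC'⟩ hyC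
      by_contra hyc
      refine hcon ⟨y, l'.reverse ++ l, c, hl'.reverse.append hl, ?_, hyC, hcC, hyc⟩
      simp only [List.mem_append, List.mem_reverse, or_imp, forall_and]
      exact ⟨hlC', hlC⟩
    · exact ⟨G.src e, fun y hy hyC => absurd ⟨y, hy, hyC⟩ h⟩
  obtain ⟨X, hXc, hcX, hpX, hqX⟩ := hX c
  -- The distance to `c`, with a negative sign on the part that hangs on `g`, is continuous.
  let d : G.Point → ℝ := fun x => dist x (G.vertex c)
  let k : G.V → ℝ := fun y => if y ∈ T then -d (G.vertex y) else d (G.vertex y)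
  let ψ : ∀ f, G.Segment f → ℝ := fun f t =>
    if f ∉ C ∧ G.src f ∈ T then -d (G.onEdge f t) else d (G.onEdge f t)
  have hglue : ∀ f y, G.src f = y ∨ G.tgt f = y →
      (if f ∉ C ∧ G.src f ∈ T then -d (G.vertex y) else d (G.vertex y)) = k y := by
    intro f y hy
    by_cases hf : f ∈ C
    · rw [if_neg (by tauto)]
      simp only [k]
      split_ifs with hyT
      · have h0 : d (G.vertex y) = 0 := by
          simp only [d, hc y hyT ⟨f, hf, hy⟩, dist_self]
        rw [h0, neg_zero]
      · rfl
    · have : G.src f ∈ T ↔ y ∈ T := by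
        rcases hy with rfl | rfl
        · rfl
        · exact hiff f hf
      simp only [k, hf, this, not_false_eq_true, true_and]
  let φ : G.Point → ℝ := glueLift k ψ
    (fun f => by simp only [ψ, onEdge_first]; exact hglue f _ (Or.inl rfl))
    (fun f => by simp only [ψ, onEdge_last]; exact hglue f _ (Or.inr rfl))
  have hd : Continuous d := by fun_prop
  have hφ : Continuous φ := by
    refine continuous_of_continuous_onEdge fun f => ?_
    change Continuous (ψ f)
    simp only [ψ]
    have := hd.comp (continuous_onEdge f)
    split_ifs
    · exact this.neg
    · exact this
  have hd0 : ∀ {x}, x ≠ G.vertex c → 0 < d x := fun h => dist_pos.2 h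
  refine not_pos_neg_of_isPreconnected hXc hφ ?_ hqX hpX ?_ ?_
  · intro x hx
    have h0 := (hd0 (x := x) (by rintro rfl; exact hcX hx)).ne'
    rcases G.point_cases x with ⟨a, rfl⟩ | ⟨f, t, -, -, rfl⟩
    · change k a ≠ 0
      simp only [k]
      split_ifs
      · exact neg_ne_zero.2 h0
      · exact h0
    · change ψ f t ≠ 0
      simp only [ψ]
      split_ifs
      · exact neg_ne_zero.2 h0
      · exact h0
  · change ψ g q < 0
    simp only [ψ]
    rw [if_pos ⟨hg, [], .nil _, by simp⟩]
    exact neg_neg_of_pos (hd0 (onEdge_ne_vertex hq.1 hq.2 c))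
  · change 0 < ψ e p
    simp only [ψ]
    rw [if_neg (fun h => h.1 he)]
    exact hd0 (onEdge_ne_vertex hp.1 hp.2 c)

/-- If the ends of `e` are joined by a walk that avoids both `e` and another edge of a shortest
return, then the closed walk formed by them has an ear. -/
theorem IsShortestReturn.exists_isEar {e g : G.E} {l : List G.E} (h : IsShortestReturn e l)
    (hg : g ∈ l) (hw : ∃ m, G.IsWalk (G.src e) m (G.tgt e) ∧ e ∉ m ∧ g ∉ m) :
    ∃ a m b, IsEar {f | f ∈ e :: l} a m b := by
  obtain ⟨l₁, l₂, rfl⟩ := List.append_of_mem hg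
  obtain ⟨m, hm, hem, hgm⟩ := hw
  have hdist : ∀ l₁' l₂' x, l₁ ++ g :: l₂ = l₁' ++ l₂' → G.IsWalk (G.src e) l₁' x →
      G.IsWalk x l₂' (G.tgt e) →
      avoidDist e (walkLength (l₁ ++ g :: l₂)) x = walkLength l₁' := by
    intro l₁' l₂' x hl h₁ h₂
    rw [hl] at h ⊢
    exact h.avoidDist_eq h₁ h₂
  have hpos := G.len_pos g
  have hsrc := hdist [] _ _ rfl (.nil _) h.isWalk
  have htgt := hdist _ [] _ (List.append_nil _).symm h.isWalk (.nil _)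
  refine exists_isEar_of_isWalk hm
    (P := fun y => avoidDist e (walkLength (l₁ ++ g :: l₂)) y ≤ walkLength l₁) ?_
    ⟨e, by simp, Or.inr rfl⟩ ?_
    ⟨_, [], .nil _, by simp, ⟨e, by simp, Or.inl rfl⟩, by
      rw [hsrc]
      exact walkLength_nonneg l₁⟩
  · intro f hf hfC
    have hfe : f ≠ e := by rintro rfl; exact hem hf
    have hfg : f ≠ g := by rintro rfl; exact hgm hf
    have hends : ∀ m₁ m₂, l₁ ++ g :: l₂ = m₁ ++ f :: m₂ →
        ∃ x y, G.Joins f x y ∧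
          avoidDist e (walkLength (l₁ ++ g :: l₂)) x = walkLength m₁ ∧
          avoidDist e (walkLength (l₁ ++ g :: l₂)) y = walkLength m₁ + G.len f := by
      intro m₁ m₂ hl
      have hw := h.isWalk
      rw [hl] at hw
      obtain ⟨x, y, h₁, hj, h₂⟩ := hw.split_cons
      refine ⟨x, y, hj, hdist _ _ _ hl h₁ (.cons hj h₂), ?_⟩
      simpa using hdist (m₁ ++ [f]) m₂ y (by rw [hl]; simp) (h₁.append hj.isWalk) h₂
    have hmem : f ∈ l₁ ∨ f ∈ l₂ := by
      simpa [hfe, hfg] using hfC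
    have hboth : (∃ x y, G.Joins f x y ∧
        (avoidDist e (walkLength (l₁ ++ g :: l₂)) x ≤ walkLength l₁ ↔
          avoidDist e (walkLength (l₁ ++ g :: l₂)) y ≤ walkLength l₁)) := by
      rcases hmem with hmem | hmem
      · obtain ⟨m₁, m₂, rfl⟩ := List.append_of_mem hmem
        obtain ⟨x, y, hj, hx, hy⟩ := hends m₁ (m₂ ++ g :: l₂) (by simp)
        refine ⟨x, y, hj, ?_⟩
        rw [hx, hy]
        simp only [walkLength_append, walkLength_cons]
        have := walkLength_nonneg m₂
        have := G.len_pos f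
        exact iff_of_true (by linarith) (by linarith)
      · obtain ⟨m₁, m₂, rfl⟩ := List.append_of_mem hmem
        obtain ⟨x, y, hj, hx, hy⟩ := hends (l₁ ++ g :: m₁) m₂ (by simp)
        refine ⟨x, y, hj, ?_⟩
        rw [hx, hy]
        simp only [walkLength_append, walkLength_cons]
        have := walkLength_nonneg m₁
        have := G.len_pos f
        exact iff_of_false (by linarith) (by linarith)
    obtain ⟨x, y, ⟨rfl, rfl⟩ | ⟨rfl, rfl⟩, hxy⟩ := hboth
    · exact hxy
    · exact hxy.symm
  · rw [htgt]
    simp only [walkLength_append, walkLength_cons]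
    linarith [walkLength_nonneg l₂]

/-- A theta-containing graph has an edge that forms a closed walk with an ear, together with some
shortest return. -/
theorem IsThetaContaining.exists_isEar (hG : G.IsThetaContaining) :
    ∃ (e : G.E) (l : List G.E), IsShortestReturn e l ∧ ∃ a m b, IsEar {f | f ∈ e :: l} a m b := by
  obtain ⟨ℓ, hℓ, F, hF⟩ := hG
  obtain ⟨e, p₁, p, p₂, hp0, hp₁, hp₂, hpl, hpr, s, hs, hsp⟩ :=
    exists_subset_range hF.continuous hF.injective 0
  obtain ⟨g, q₁, q, q₂, hq0, hq₁, hq₂, hql, hqr, t, ht, htq⟩ :=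
    exists_subset_range hF.continuous hF.injective 1
  have himage : ∀ {Z : Set (theta ℓ hℓ).Point}, IsPreconnected Zᶜ → IsPreconnected (F '' Zᶜ) :=
    fun h => h.image _ hF.continuous.continuousOn
  have hsub : ∀ {Z : Set (theta ℓ hℓ).Point} {x}, x ∈ range F → (∀ z ∈ Z, x ≠ F z) →
      x ∈ F '' Zᶜ := by
    rintro Z _ ⟨y, rfl⟩ h
    exact ⟨y, fun hy => h y hy rfl, rfl⟩
  have hnot : ∀ {Z : Set (theta ℓ hℓ).Point} {z}, z ∈ Z → F z ∉ F '' Zᶜ := by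
    rintro Z z hz ⟨y, hy, hyz⟩
    exact hy (hF.injective hyz ▸ hz)
  have hpi : 0 < (p : ℝ) ∧ (p : ℝ) < G.len e := ⟨by linarith, by linarith⟩
  have hqi : 0 < (q : ℝ) ∧ (q : ℝ) < G.len g := ⟨by linarith, by linarith⟩
  have hpne : ∀ {x : G.Segment e}, (x : ℝ) ≠ p → G.onEdge e x ≠ G.onEdge e p := fun h h' =>
    h (eq_of_onEdge_eq hpi.1 hpi.2 h'.symm).2
  have hret : ∃ l, G.IsWalk (G.src e) l (G.tgt e) ∧ e ∉ l := by
    obtain ⟨l, hl, hle⟩ := exists_isWalk_of_isPreconnected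
      (himage (isPreconnected_theta_compl_singleton ((theta ℓ hℓ).edgePath (0 : Fin 3) s)))
      (Z := {e}) (m := fun _ => p) (by rintro f rfl; exact hpi)
      (by
        rintro f rfl x hx
        rw [Subtype.ext hx, ← hsp]
        exact hnot rfl) (e := e) rfl (p := p₁) (q := p₂)
      (hsub (hpr p₁ le_rfl (by linarith)) (by rintro z rfl; rw [hsp]; exact hpne hp₁.ne))
      (hsub (hpr p₂ (by linarith) le_rfl) (by rintro z rfl; rw [hsp]; exact hpne hp₂.ne')) hp₁ hp₂
    exact ⟨l, hl, fun h => hle e h rfl⟩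
  obtain ⟨l, ⟨hl, hle⟩, hmin⟩ := exists_min_walkLength hret
  have hsr : IsShortestReturn e l := ⟨hl, hle, fun l' h h' => hmin l' ⟨h, h'⟩⟩
  refine ⟨e, l, hsr, ?_⟩
  by_cases hgC : g ∈ e :: l
  · -- Connectedness with points of both `e` and `g` removed links the two arcs of the closed walk.
    have hpair := himage (isPreconnected_theta_compl_pair (hℓ := hℓ) (i := 0) (j := 1)
      (by decide) hs ht)
    have hpX : G.onEdge e p ∉ F '' ({(theta ℓ hℓ).edgePath (0 : Fin 3) s,
        (theta ℓ hℓ).edgePath (1 : Fin 3) t}ᶜ : Set _) := by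
      rw [← hsp]
      exact hnot (Or.inl rfl)
    have hqX : G.onEdge g q ∉ F '' ({(theta ℓ hℓ).edgePath (0 : Fin 3) s,
        (theta ℓ hℓ).edgePath (1 : Fin 3) t}ᶜ : Set _) := by
      rw [← htq]
      exact hnot (Or.inr rfl)
    have hpq : G.onEdge e p ≠ G.onEdge g q := fun h => by
      rw [← hsp, ← htq] at h
      have h10 : (1 : Fin 3) = 0 := (edgePath_interior_inj (G := theta ℓ hℓ) (e := (0 : Fin 3))
        (f := (1 : Fin 3)) hs (Ioo_subset_Icc_self ht) (hF.injective h)).1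
      exact absurd h10 (by decide)
    have hX : ∀ x : G.Segment e, (p₁ : ℝ) ≤ x → (x : ℝ) ≤ p₂ → (x : ℝ) ≠ p →
        G.onEdge e x ≠ G.onEdge g q → G.onEdge e x ∈ F '' ({(theta ℓ hℓ).edgePath (0 : Fin 3) s,
        (theta ℓ hℓ).edgePath (1 : Fin 3) t}ᶜ : Set _) := by
      intro x h₁ h₂ h₃ h₄
      refine hsub (hpr x h₁ h₂) ?_
      rintro z (rfl | rfl)
      · rw [hsp]
        exact hpne h₃
      · rw [htq]
        exact h₄
    by_cases hge : g = e
    · exfalso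
      subst hge
      have hqp : (q : ℝ) ≠ p := fun h => hpq (by rw [Subtype.ext h])
      have hX' : ∀ x : G.Segment g, (p₁ : ℝ) ≤ x → (x : ℝ) ≤ p₂ → (x : ℝ) ≠ p →
          (x : ℝ) ≠ q → G.onEdge g x ∈ F '' ({(theta ℓ hℓ).edgePath (0 : Fin 3) s,
          (theta ℓ hℓ).edgePath (1 : Fin 3) t}ᶜ : Set _) := fun x h₁ h₂ h₃ h₄ =>
        hX x h₁ h₂ h₃ fun h => h₄ (eq_of_onEdge_eq hqi.1 hqi.2 h.symm).2
      rcases hqp.lt_or_gt with hlt | hlt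
      · -- A point of `X` between `q` and `p`, and one to the right of both.
        obtain ⟨r, hr₁, hr₂⟩ := exists_between (max_lt hp₁ hlt)
        obtain ⟨hr₁, hr₁'⟩ := max_lt_iff.1 hr₁
        exact false_of_isPreconnected hpair hqi.1 hlt hpi.2 hqX hpX
          (hX' ⟨r, by linarith, by linarith⟩ hr₁.le (by change r ≤ _; linarith) hr₂.ne hr₁'.ne')
          (hX' p₂ (by linarith) le_rfl hp₂.ne' (by linarith : (q : ℝ) < p₂).ne') hr₁' hr₂
          (Or.inr hp₂)
      · obtain ⟨r, hr₁, hr₂⟩ := exists_between (lt_min hp₂ hlt)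
        obtain ⟨hr₂, hr₂'⟩ := lt_min_iff.1 hr₂
        exact false_of_isPreconnected hpair hpi.1 hlt hqi.2 hpX hqX
          (hX' ⟨r, by linarith, by linarith⟩ (by change _ ≤ r; linarith) hr₂.le hr₁.ne' hr₂'.ne)
          (hX' p₁ le_rfl (by linarith) hp₁.ne (by linarith : (p₁ : ℝ) < q).ne) hr₁ hr₂'
          (Or.inl hp₁)
    · have hgl : g ∈ l := (List.mem_cons.1 hgC).resolve_left hge
      have hne : ∀ x : G.Segment e, G.onEdge e x ≠ G.onEdge g q := fun x h =>
        hge (eq_of_onEdge_eq hqi.1 hqi.2 h.symm).1.symm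
      classical
      obtain ⟨m, hm, hmZ⟩ := exists_isWalk_of_isPreconnected hpair (Z := {e, g})
        (m := fun f => if f = e then (p : ℝ) else q)
        (by
          rintro f (rfl | rfl)
          · simpa using hpi
          · simpa [hge] using hqi)
        (by
          rintro f (rfl | rfl) x hx
          · rw [if_pos rfl] at hx
            rw [Subtype.ext hx]
            exact hpX
          · rw [if_neg hge] at hx
            rw [Subtype.ext hx]
            exact hqX) (e := e) (Or.inl rfl) (p := p₁) (q := p₂)
        (hX p₁ le_rfl (by linarith) hp₁.ne (hne p₁)) (hX p₂ (by linarith) le_rfl hp₂.ne' (hne p₂))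
        (by simpa using hp₁) (by simpa using hp₂)
      exact hsr.exists_isEar hgl
        ⟨m, hm, fun h => hmZ e h (Or.inl rfl), fun h => hmZ g h (Or.inr rfl)⟩
  · refine exists_isEar_of_notMem (C := {f | f ∈ e :: l}) (e := e) (g := g) (by simp) hgC hpi hqi ?_
    intro a
    obtain ⟨z, hz, hz'⟩ : ∃ z, (∀ i, ∀ r ∈ Ioo 0 (ℓ i), ∀ (f : G.E) (x : G.Segment f),
        0 < (x : ℝ) → (x : ℝ) < G.len f → F ((theta ℓ hℓ).edgePath i r) = G.onEdge f x →
        G.onEdge f x ≠ F z) ∧ G.vertex a ∉ F '' {z}ᶜ := by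
      by_cases ha : G.vertex a ∈ range F
      · obtain ⟨z, hz⟩ := ha
        refine ⟨z, fun i r _ f x h₀ h₁ _ h => onEdge_ne_vertex h₀ h₁ a (h.trans hz), ?_⟩
        rw [← hz]
        exact hnot rfl
      · refine ⟨(theta ℓ hℓ).vertex false, fun i r hr f x _ _ hx h => ?_, ?_⟩
        · rw [← hx] at h
          exact edgePath_ne_vertex (G := theta ℓ hℓ) (e := i) hr _ (hF.injective h)
        · rintro ⟨y, -, hy⟩
          exact ha ⟨y, hy⟩
    refine ⟨F '' {z}ᶜ, himage (isPreconnected_theta_compl_singleton z), hz', ?_, ?_⟩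
    · exact hsub ⟨_, hsp⟩ (by rintro _ rfl; exact hz _ _ hs _ _ hpi.1 hpi.2 hsp)
    · exact hsub ⟨_, htq⟩ (by rintro _ rfl; exact hz _ _ ht _ _ hqi.1 hqi.2 htq)

/-! ### The negative type gap -/

theorem exists_violation_of_isThetaContaining (hG : G.IsThetaContaining)
    (hlen : ∀ e, 1 ≤ G.len e) :
    ∃ R B : Finset G.Point, R.card = 3 ∧ B.card = 3 ∧ Disjoint R B ∧
      1 / 12 ≤ pairSum R + pairSum B - ∑ x ∈ R, ∑ y ∈ B, dist x y := by
  obtain ⟨e, l, hl, hear⟩ := hG.exists_isEar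
  obtain ⟨f, hf, a, b, ha, hb, hab⟩ := exists_edge_of_isEar hlen hear
  obtain ⟨c, hc, hcover, hsurj⟩ := hl.exists_isometry
  have hend : ∀ y, IsEndOf {f | f ∈ e :: l} y → ∃ θ, c θ = G.vertex y := by
    rintro y ⟨g, hg, rfl | rfl⟩
    · rw [← onEdge_first]
      exact hsurj g hg _
    · rw [← onEdge_last]
      exact hsurj g hg _
  obtain ⟨p, hp⟩ := hend a ha
  obtain ⟨q, hq⟩ := hend b hb
  refine exists_six_points (by linarith [walkLength_nonneg l, G.len_pos e]) hc (f := f) ?_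
    (p := p) (q := q) (by rw [hp, hq]; exact hab)
  intro θ t h₀ h₁ h
  obtain ⟨g, hg, s, hs⟩ := hcover θ
  rw [hs] at h
  have := (eq_of_onEdge_eq h₀ h₁ h.symm).1
  exact hf (this ▸ hg)

end MetricGraph

open Classical in
theorem redBlueWeight_apply {M : Type*} {R B : Finset M} (x : M) :
    redBlueWeight R B x = (if x ∈ R then 1 / 6 else 0) - (if x ∈ B then 1 / 6 else 0) := by
  simp [redBlueWeight, Finsupp.single_apply, Finset.sum_ite_eq']

open Classical in
theorem support_redBlueWeight {M : Type*} {R B : Finset M} (h : Disjoint R B) :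
    (redBlueWeight R B).support = R ∪ B := by
  ext x
  rw [Finsupp.mem_support_iff, redBlueWeight_apply, Finset.mem_union]
  by_cases hR : x ∈ R
  · have hB : x ∉ B := Finset.disjoint_left.1 h hR
    simp [hR, hB]
  · by_cases hB : x ∈ B <;> simp [hR, hB]

open Classical in
theorem sum_redBlueWeight {M : Type*} {R B : Finset M} (h : Disjoint R B) (g : ℝ → M → ℝ) :
    ∑ x ∈ (redBlueWeight R B).support, g (redBlueWeight R B x) x =
      ∑ x ∈ R, g (1 / 6) x + ∑ x ∈ B, g (-(1 / 6)) x := by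
  rw [support_redBlueWeight h, Finset.sum_union h]
  congr 1
  · refine Finset.sum_congr rfl fun x hx => ?_
    rw [redBlueWeight_apply, if_pos hx, if_neg (Finset.disjoint_left.1 h hx), sub_zero]
  · refine Finset.sum_congr rfl fun x hx => ?_
    rw [redBlueWeight_apply, if_pos hx, if_neg (Finset.disjoint_right.1 h hx), zero_sub]

theorem isGapWeight_redBlueWeight {M : Type*} {R B : Finset M} (h : Disjoint R B)
    (hR : R.card = 3) (hB : B.card = 3) : IsGapWeight (redBlueWeight R B) := by
  constructor
  · rw [sum_redBlueWeight h fun w _ => w]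
    simp [hR, hB]
  · rw [sum_redBlueWeight h fun w _ => |w|]
    simp [hR, hB, abs_of_pos]
    norm_num

theorem gammaForm_redBlueWeight {M : Type*} [MetricSpace M] {R B : Finset M} (h : Disjoint R B) :
    gammaForm (redBlueWeight R B) =
      (pairSum R + pairSum B - ∑ x ∈ R, ∑ y ∈ B, dist x y) / 18 := by
  have hin : ∀ (r : ℝ) (x : M), ∑ y ∈ (redBlueWeight R B).support,
      r * redBlueWeight R B y * dist x y =
      r / 6 * (∑ y ∈ R, dist x y - ∑ y ∈ B, dist x y) := fun r x => by
    rw [sum_redBlueWeight h fun w y => r * w * dist x y, ← Finset.mul_sum, ← Finset.mul_sum]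
    ring
  have hBR : ∑ x ∈ B, ∑ y ∈ R, dist x y = ∑ x ∈ R, ∑ y ∈ B, dist x y := by
    rw [Finset.sum_comm]
    simp only [dist_comm]
  simp only [gammaForm, hin]
  rw [sum_redBlueWeight h fun w x => w / 6 * (∑ y ∈ R, dist x y - ∑ y ∈ B, dist x y),
    ← Finset.mul_sum, ← Finset.mul_sum, Finset.sum_sub_distrib, Finset.sum_sub_distrib, hBR,
    pairSum, pairSum]
  ring

theorem mainTheorem3 :
    ((1 / 432 : ℝ) : EReal) ≤ negativeTypeGapInf thetaFamily.{u, v} ∧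
    ∀ G ∈ thetaFamily.{u, v}, ∃ R B : Finset G.Point,
      R.card = 3 ∧ B.card = 3 ∧ Disjoint R B ∧
      1 / 12 ≤ pairSum R + pairSum B - ∑ x ∈ R, ∑ y ∈ B, dist x y ∧
      IsGapWeight (redBlueWeight R B) ∧
      1 / 432 ≤ gammaForm (redBlueWeight R B) := by
  have key : ∀ G ∈ thetaFamily.{u, v}, ∃ R B : Finset G.Point,
      R.card = 3 ∧ B.card = 3 ∧ Disjoint R B ∧
      1 / 12 ≤ pairSum R + pairSum B - ∑ x ∈ R, ∑ y ∈ B, dist x y ∧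
      IsGapWeight (redBlueWeight R B) ∧
      1 / 432 ≤ gammaForm (redBlueWeight R B) := by
    rintro G ⟨hG, hlen⟩
    obtain ⟨R, B, hR, hB, hRB, h⟩ := MetricGraph.exists_violation_of_isThetaContaining hG hlen
    refine ⟨R, B, hR, hB, hRB, h, isGapWeight_redBlueWeight hRB hR hB, ?_⟩
    rw [gammaForm_redBlueWeight hRB]
    linarith
  refine ⟨le_iInf₂ fun G hG => ?_, key⟩
  obtain ⟨R, B, -, -, -, -, hw, h⟩ := key G hG
  exact (EReal.coe_le_coe_iff.2 h).trans (le_iSup₂_of_le (redBlueWeight R B) hw le_rfl)
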